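/- Let $a,b,s,t$ be positive integers with $b<a$ and $t\le s$, put $r=a+b$, and let $0<\gamma<1/t$. For $n\in\mathbb N$ and real $m>0$ put $$f(m)=f_{r,n}(m)=m^{-1/r}n^{r-1}+m^2n^{r-2}.$$ An $r$-graph on a finite vertex set is identified with its set of edges, which are $r$-element subsets of the vertex set. For a tree $T$ with bipartition $(U,V)$, $U=\{u_1,\dots,u_s\}$, $V=\{v_1,\dots,v_t\}$, the $(a,b)$-blowup $T(a,b)$ is the $r$-graph with edges $U_i\cup V_j$ for $u_iv_j\in E(T)$, where $U_1,\dots,U_s,V_1,\dots,V_t$ are pairwise disjoint sets with $|U_i|=a$ and $|V_j|=b$. An $r$-graph is $\mathcal T$-free if it contains no (not necessarily induced) copy of $\mathcal T$. A crosscut of an $r$-graph $F$ is a set $L$ of vertices with $|e\cap L|=1$ for every $e\in F$. Then there is $n_0=n_0(a,b,s,t,\gamma)$ such that for every constant $C$ there is a constant $C'=C'(a,b,s,t,\gamma,C)$ with the following property. Let $n\ge n_0$, let $m$ be a real number with $r^r<m\le n^{\gamma}$, let $\mathcal T=T(a,b)$ for a tree $T$ with parts of sizes $|U|=s$ and $|V|=t$,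 and let $H$ be a $\mathcal T$-free $r$-graph on $n$ vertices with $$\left|\,|H|-(t-1)\binom{n}{r-1}\right|\le C\,f(m).$$ Then there is a subfamily $F\subseteq H$ with $|F|\ge |H|-C'f(m)$ that has a crosscut $L$ of size $|L|\le C'm$. -/

import Mathlib

namespace HypergraphBlowup

/-- Bipartite trees with parts `U = Fin s` (left summand) and `V = Fin t` (right summand). -/
def IsTreeWithParts (s t : ℕ) (T : SimpleGraph (Fin s ⊕ Fin t)) : Prop :=
  T.IsTree ∧ T ≤ completeBipartiteGraph (Fin s) (Fin t)

/-- Vertices of an `(a, b)`-blowup: each `u i` is replaced by the `a`-set `{i} × Fin a`, and each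
`v j` by the `b`-set `{j} × Fin b`. -/
abbrev BlowupVertex (s t a b : ℕ) : Type := (Fin s × Fin a) ⊕ (Fin t × Fin b)

/-- The `a`-set `U i` replacing the vertex `u i`. -/
def leftBlock {s : ℕ} (t a b : ℕ) (i : Fin s) : Finset (BlowupVertex s t a b) :=
  Finset.univ.image fun k : Fin a => Sum.inl (i, k)

/-- The `b`-set `V j` replacing the vertex `v j`. -/
def rightBlock {t : ℕ} (s a b : ℕ) (j : Fin t) : Finset (BlowupVertex s t a b) :=
  Finset.univ.image fun k : Fin b => Sum.inr (j, k)

open Classical in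
/-- The `(a, b)`-blowup of a bipartite graph `T`: its edges are the sets `U i ∪ V j` over the edges
`u i v j` of `T`. -/
noncomputable def blowup {s t : ℕ} (T : SimpleGraph (Fin s ⊕ Fin t)) (a b : ℕ) :
    Finset (Finset (BlowupVertex s t a b)) :=
  Finset.univ.filter fun e => ∃ (i : Fin s) (j : Fin t),
    T.Adj (Sum.inl i) (Sum.inr j) ∧ e = leftBlock t a b i ∪ rightBlock s a b j

/-- An `r`-graph, given by its edge set. -/
def IsUniform {α : Type*} (H : Finset (Finset α)) (r : ℕ) : Prop :=
  ∀ e ∈ H, e.card = r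

/-- `H` contains a (not necessarily induced) copy of `P`. -/
def ContainsCopy {α β : Type*} (H : Finset (Finset α)) (P : Finset (Finset β)) : Prop :=
  ∃ φ : β ↪ α, ∀ e ∈ P, e.map φ ∈ H

/-- A set of vertices meeting every edge in exactly one vertex. -/
def IsCrosscut {α : Type*} [DecidableEq α] (H : Finset (Finset α)) (X : Finset α) : Prop :=
  ∀ e ∈ H, (e ∩ X).card = 1

/-- The error term `f(m) = m ^ (-1/r) * n ^ (r-1) + m ^ 2 * n ^ (r-2)`. -/
noncomputable def errorTerm (r n : ℕ) (m : ℝ) : ℝ :=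
  m ^ (-(1 / (r : ℝ))) * (n : ℝ) ^ (r - 1) + m ^ 2 * (n : ℝ) ^ (r - 2)

end HypergraphBlowup

/-!
Let `κ` be a large constant times `n * m ^ (-1 / r)` and let `L` be the set of vertices of degree at
least `κ ^ (r - 1)` up to a constant. As `H` has `O(n ^ (r - 1))` edges, `|L| = O(m)`, so only
`O(m ^ 2 * n ^ (r - 2))` edges meet `L` twice. Let `F` consist of the edges that meet `L` exactly once.
It remains to see that the hypergraph `G` of edges avoiding `L` has `O(f(m))` edges.

Consider all orderings of the edges of `G` as `r`-tuples. If there are many more than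
`κ * n ^ (r - 2)` of them, they contain a core which is uniform (`exists_uniform_core`): every
coordinate is *large*, meaning that it can always be changed in at least `κ` ways, or *small*, meaning
that it can always be changed in fewer than `κ` ways, while any two coordinates together can be changed
in many more than `κ` ways. With at most one small coordinate, some vertex would have degree
`κ ^ (r - 1)`, so there are at least two. As `a > b`, the coordinates then split into parts of sizes `a`
and `b`, neither containing exactly one small coordinate, unless `b = 1` and all coordinates are small
(`exists_split`). Given such a split, either part of an edge in the core can be replaced while keeping
the other part and avoiding any few given vertices (`exists_refresh`), so the blowup of any tree embeds
greedily. Hence `|G| = O(κ * n ^ (r - 2))` if `b ≥ 2`.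

If `b = 1`, the same argument shows that all but `O(κ * n ^ (r - 2))` edges of `G` contain only
`(r - 1)`-sets of degree `O(κ)`. Let `G₁` be the family of these edges, and consider the pairs `(S, v)`
where `S` is an `(r - 1)`-set and `S ∪ {v}` is in `G₁`, or is in `F` with `v` in `L`. There are
`|F| + r * |G₁|` pairs. If many sets `S` had more than `t - 1` partners, then a core in which each set
has at least `t` partners and each vertex many would contain the blowup (`card_incidence_le`). So
`|F| + r * |G₁| ≤ (t - 1) * C(n, r - 1) + O(f(m))`, and comparison with the lower bound on `|H|` gives
`(r - 1) * |G₁| = O(f(m))`.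
-/

namespace HypergraphBlowup

/-! ### Greedy embedding of trees -/

/-- A tree is embedded vertex by vertex: if every admissible partial assignment of pairwise disjoint
sets to tree vertices extends to a neighbour of an assigned vertex, then the whole tree embeds. The
induction removes a leaf, so that the last vertex has a single neighbour to be respected. -/
theorem exists_tree_assignment {α : Type*} [DecidableEq α] (H : Finset (Finset α)) (k : ℕ) :
    ∀ (W : Type) [Fintype W] [DecidableEq W] (T : SimpleGraph W) (P : W → Finset α → Prop),
      T.IsTree → Fintype.card W = k → (∀ w, ∃ x, P w x) →
      (∀ (S : Finset W) (φ : W → Finset α), (∀ w ∈ S, P w (φ w)) →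
        (∀ u ∈ S, ∀ v ∈ S, u ≠ v → Disjoint (φ u) (φ v)) →
        ∀ w ∈ S, ∀ w' ∉ S, T.Adj w w' →
          ∃ x, P w' x ∧ φ w ∪ x ∈ H ∧ ∀ u ∈ S, Disjoint (φ u) x) →
      ∃ φ : W → Finset α, (∀ w, P w (φ w)) ∧ (∀ u v, u ≠ v → Disjoint (φ u) (φ v)) ∧
        ∀ u v, T.Adj u v → φ u ∪ φ v ∈ H := by
  classical
  induction k with
  | zero =>
    intro W _ _ T P hT hk
    have := hT.connected.nonempty
    exact absurd hk Fintype.card_ne_zero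
  | succ k ih =>
    intro W _ _ T P hT hk h0 hext
    rcases subsingleton_or_nontrivial W with hW | hW
    · choose φ hφ using h0
      exact ⟨φ, hφ, fun u v huv => absurd (Subsingleton.elim u v) huv,
        fun u v huv => absurd (Subsingleton.elim u v) huv.ne⟩
    obtain ⟨v, hv⟩ := hT.exists_vert_degree_one_of_nontrivial
    obtain ⟨p, hp, hpu⟩ := (SimpleGraph.degree_eq_one_iff_existsUnique_adj).1 hv
    have hT' : (T.induce ({v}ᶜ : Set W)).IsTree :=
      ⟨hT.connected.induce_compl_singleton_of_degree_eq_one hv, hT.isAcyclic.induce _⟩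
    have hpv : p ∈ ({v}ᶜ : Set W) := by simpa using hp.ne'
    obtain ⟨φ, hP, hD, hA⟩ := ih ({v}ᶜ : Set W) (T.induce ({v}ᶜ : Set W)) (fun w => P w) hT'
      (by rw [Fintype.card_compl_set]; simp [hk]) (fun w => h0 w) (by
        intro S φ hP hD w hw w' hw' hadj
        let ψ : W → Finset α := fun x => if hx : x ∈ ({v}ᶜ : Set W) then φ ⟨x, hx⟩ else ∅
        have hψ : ∀ x : ({v}ᶜ : Set W), ψ x = φ x := fun x => by
          simp only [ψ, x.2, dif_pos]
        obtain ⟨x, hx1, hx2, hx3⟩ := hext (S.map (Function.Embedding.subtype _)) ψ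
          (by
            intro y hy
            obtain ⟨z, hz, rfl⟩ := Finset.mem_map.1 hy
            simpa [hψ] using hP z hz)
          (by
            intro y hy y' hy' hne
            obtain ⟨z, hz, rfl⟩ := Finset.mem_map.1 hy
            obtain ⟨z', hz', rfl⟩ := Finset.mem_map.1 hy'
            have := hD z hz z' hz' (fun h => hne (by rw [h]))
            simpa only [Function.Embedding.subtype_apply, hψ] using this)
          w (Finset.mem_map.2 ⟨w, hw, rfl⟩) w' (by
            intro h
            obtain ⟨z, hz, hzw⟩ := Finset.mem_map.1 h
            exact hw' (by rwa [← Subtype.ext hzw])) hadj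
        refine ⟨x, hx1, by rwa [hψ] at hx2, fun u hu => ?_⟩
        have := hx3 u (Finset.mem_map.2 ⟨u, hu, rfl⟩)
        rwa [hψ] at this)
    let ψ : W → Finset α := fun x => if hx : x ∈ ({v}ᶜ : Set W) then φ ⟨x, hx⟩ else ∅
    have hψ : ∀ x (hx : x ≠ v), ψ x = φ ⟨x, hx⟩ := fun x hx => by
      have : x ∈ ({v}ᶜ : Set W) := hx
      simp only [ψ, this, dif_pos]
    obtain ⟨x, hx1, hx2, hx3⟩ := hext (Finset.univ.erase v) ψ
      (by
        intro w hw
        have hw' : w ≠ v := Finset.ne_of_mem_erase hw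
        rw [hψ w hw']
        exact hP ⟨w, hw'⟩)
      (by
        intro u hu w hw hne
        rw [hψ u (Finset.ne_of_mem_erase hu), hψ w (Finset.ne_of_mem_erase hw)]
        exact hD _ _ (fun h => hne (congrArg Subtype.val h)))
      p (by simpa using hp.ne') v (by simp) hp.symm
    refine ⟨Function.update ψ v x, ?_, ?_, ?_⟩
    · intro w
      by_cases hw : w = v
      · subst hw; simpa using hx1
      · rw [Function.update_of_ne hw, hψ w hw]
        exact hP ⟨w, hw⟩
    · intro u w huw
      by_cases hu : u = v
      · subst hu
        rw [Function.update_self, Function.update_of_ne huw.symm]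
        exact (hx3 w (by simpa using huw.symm)).symm
      · by_cases hw : w = v
        · subst hw
          rw [Function.update_self, Function.update_of_ne hu]
          exact hx3 u (by simpa using hu)
        · rw [Function.update_of_ne hu, Function.update_of_ne hw, hψ u hu, hψ w hw]
          exact hD _ _ (fun h => huw (congrArg Subtype.val h))
    · intro u w huw
      by_cases hu : u = v
      · subst hu
        have := hpu w huw
        subst this
        rw [Function.update_self, Function.update_of_ne huw.ne', Finset.union_comm]
        exact hx2
      · by_cases hw : w = v
        · subst hw
          have := hpu u huw.symm
          subst this
          rw [Function.update_self, Function.update_of_ne hu]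
          exact hx2
        · rw [Function.update_of_ne hu, Function.update_of_ne hw, hψ u hu, hψ w hw]
          exact hA ⟨u, hu⟩ ⟨w, hw⟩ huw

/-- An assignment of pairwise disjoint blocks of the right sizes to the vertices of `T`, adjacent
blocks having their union in `H`, is a copy of the blowup. -/
theorem containsCopy_blowup_of_assignment {α : Type*} [DecidableEq α] {H : Finset (Finset α)}
    {s t a b : ℕ} {T : SimpleGraph (Fin s ⊕ Fin t)} (φ : Fin s ⊕ Fin t → Finset α)
    (ha : ∀ i, (φ (Sum.inl i)).card = a) (hb : ∀ j, (φ (Sum.inr j)).card = b)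
    (hd : ∀ u v, u ≠ v → Disjoint (φ u) (φ v))
    (hT : ∀ u v, T.Adj u v → φ u ∪ φ v ∈ H) : ContainsCopy H (blowup T a b) := by
  classical
  let ea : ∀ i, φ (Sum.inl i) ≃ Fin a := fun i => Finset.equivFinOfCardEq (ha i)
  let eb : ∀ j, φ (Sum.inr j) ≃ Fin b := fun j => Finset.equivFinOfCardEq (hb j)
  let g : BlowupVertex s t a b → α := Sum.elim (fun p => ((ea p.1).symm p.2 : α))
    (fun p => ((eb p.1).symm p.2 : α))
  let w : BlowupVertex s t a b → Fin s ⊕ Fin t := Sum.map Prod.fst Prod.fst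
  have hg : ∀ x, g x ∈ φ (w x) := by
    rintro (⟨i, k⟩ | ⟨j, k⟩)
    · exact ((ea i).symm k).2
    · exact ((eb j).symm k).2
  have hginj : Function.Injective g := by
    intro x y hxy
    have hw : w x = w y := by
      by_contra hne
      exact Finset.disjoint_left.1 (hd _ _ hne) (hg x) (hxy ▸ hg y)
    rcases x with ⟨i, k⟩ | ⟨j, k⟩ <;> rcases y with ⟨i', k'⟩ | ⟨j', k'⟩
    · have hi : i = i' := by simpa [w] using hw
      subst hi
      have h : k = k' := (ea i).symm.injective (Subtype.ext hxy)
      rw [h]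
    · simp [w] at hw
    · simp [w] at hw
    · have hj : j = j' := by simpa [w] using hw
      subst hj
      have h : k = k' := (eb j).symm.injective (Subtype.ext hxy)
      rw [h]
  have hl : ∀ i, (leftBlock t a b i).map ⟨g, hginj⟩ = φ (Sum.inl i) := by
    intro i
    ext x
    simp only [leftBlock, Finset.mem_map, Finset.mem_image, Finset.mem_univ, true_and]
    constructor
    · rintro ⟨_, ⟨k, rfl⟩, rfl⟩
      exact hg (Sum.inl (i, k))
    · intro hx
      refine ⟨_, ⟨ea i ⟨x, hx⟩, rfl⟩, ?_⟩
      simp [g]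
  have hr : ∀ j, (rightBlock s a b j).map ⟨g, hginj⟩ = φ (Sum.inr j) := by
    intro j
    ext x
    simp only [rightBlock, Finset.mem_map, Finset.mem_image, Finset.mem_univ, true_and]
    constructor
    · rintro ⟨_, ⟨k, rfl⟩, rfl⟩
      exact hg (Sum.inr (j, k))
    · intro hx
      refine ⟨_, ⟨eb j ⟨x, hx⟩, rfl⟩, ?_⟩
      simp [g]
  refine ⟨⟨g, hginj⟩, fun e he => ?_⟩
  simp only [blowup, Finset.mem_filter, Finset.mem_univ, true_and] at he
  obtain ⟨i, j, hij, rfl⟩ := he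
  have := hT _ _ hij
  rw [← hl i, ← hr j, ← Finset.map_union] at this
  convert this

/-! ### Families of tuples with uniform degrees -/

section Tuples

variable {ι α : Type*} [Fintype ι] [DecidableEq ι] [DecidableEq α]

/-- The members of `C` that agree with `f` outside the coordinates in `P`. Its cardinality is the
degree in `C` of the partial tuple obtained from `f` by forgetting the coordinates in `P`. -/
def fiber (C : Finset (ι → α)) (P : Finset ι) (f : ι → α) : Finset (ι → α) :=
  C.filter fun g => ∀ i ∉ P, g i = f i

theorem mem_fiber {C : Finset (ι → α)} {P : Finset ι} {f g : ι → α} :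
    g ∈ fiber C P f ↔ g ∈ C ∧ ∀ i ∉ P, g i = f i := by
  simp [fiber]

theorem fiber_mono {C C' : Finset (ι → α)} (h : C ⊆ C') (P : Finset ι) (f : ι → α) :
    fiber C P f ⊆ fiber C' P f :=
  Finset.filter_subset_filter _ h

theorem fiber_congr (C : Finset (ι → α)) {P : Finset ι} {f g : ι → α}
    (h : ∀ i ∉ P, g i = f i) : fiber C P g = fiber C P f := by
  ext x
  simp only [mem_fiber]
  refine and_congr_right fun _ => forall_congr' fun i => forall_congr' fun hi => ?_
  rw [h i hi]

theorem fiber_eq_filter_restrict (C : Finset (ι → α)) (P : Finset ι) (f : ι → α) :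
    fiber C P f = C.filter fun g =>
      (fun i : {i // i ∉ P} => g i) = fun i : {i // i ∉ P} => f i := by
  ext g
  simp [fiber, funext_iff]

/-- Either `G` contains a nonempty core all of whose `P`-degrees are at least `τ P`, or, by removing
tuples of low degree one at a time and recording the reason for each removal, `G` splits into classes
such that the class of reason `P` has `P`-degrees less than `τ P`. -/
theorem exists_core_or_partition (D : Finset (Finset ι)) (τ : Finset ι → ℕ)
    (G : Finset (ι → α)) :
    (∃ C ⊆ G, C.Nonempty ∧ ∀ P ∈ D, ∀ f ∈ C, τ P ≤ (fiber C P f).card) ∨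
      ∃ c : (ι → α) → Finset ι, ∀ f ∈ G, c f ∈ D ∧
        (fiber (G.filter fun g => c g = c f) (c f) f).card < τ (c f) := by
  induction G using Finset.strongInduction with
  | H G ih =>
    by_cases hG : G.Nonempty ∧ ∀ P ∈ D, ∀ f ∈ G, τ P ≤ (fiber G P f).card
    · exact Or.inl ⟨G, subset_rfl, hG⟩
    rcases G.eq_empty_or_nonempty with rfl | hne
    · exact Or.inr ⟨fun _ => ∅, by simp⟩
    simp only [hne, true_and, not_forall, not_le] at hG
    obtain ⟨P, hP, e, he, hlt⟩ := hG
    rcases ih (G.erase e) (Finset.erase_ssubset he) with ⟨C, hC, h⟩ | ⟨c, hc⟩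
    · exact Or.inl ⟨C, hC.trans (Finset.erase_subset _ _), h⟩
    · refine Or.inr ⟨Function.update c e P, fun f hf => ?_⟩
      by_cases hfe : f = e
      · subst hfe
        rw [Function.update_self]
        exact ⟨hP, (Finset.card_le_card (fiber_mono (Finset.filter_subset _ _) _ _)).trans_lt hlt⟩
      · rw [Function.update_of_ne hfe]
        obtain ⟨h1, h2⟩ := hc f (Finset.mem_erase.2 ⟨hfe, hf⟩)
        refine ⟨h1, ?_⟩
        by_cases hin : c f = P ∧ ∀ i ∉ P, e i = f i
        · obtain ⟨hcP, hef⟩ := hin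
          rw [hcP, ← fiber_congr _ hef]
          exact (Finset.card_le_card (fiber_mono (Finset.filter_subset _ _) _ _)).trans_lt hlt
        · refine (Finset.card_le_card ?_).trans_lt h2
          intro g hg
          rw [mem_fiber, Finset.mem_filter] at hg ⊢
          obtain ⟨⟨hgG, hgc⟩, hgf⟩ := hg
          have hge : g ≠ e := by
            rintro rfl
            rw [Function.update_self] at hgc
            exact hin ⟨hgc.symm, hgc ▸ hgf⟩
          rw [Function.update_of_ne hge] at hgc
          exact ⟨⟨Finset.mem_erase.2 ⟨hge, hgG⟩, hgc⟩, hgf⟩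

theorem exists_core_or_large_class (D : Finset (Finset ι)) (τ : Finset ι → ℕ)
    (G : Finset (ι → α)) (hG : G.Nonempty) :
    (∃ C ⊆ G, C.Nonempty ∧ ∀ P ∈ D, ∀ f ∈ C, τ P ≤ (fiber C P f).card) ∨
      ∃ P ∈ D, ∃ G' ⊆ G, G.card ≤ D.card * G'.card ∧
        ∀ f ∈ G', (fiber G' P f).card < τ P := by
  rcases exists_core_or_partition D τ G with h | ⟨c, hc⟩
  · exact Or.inl h
  right
  by_contra! hcon
  have hlt : ∀ P ∈ D, D.card * (G.filter fun g => c g = P).card < G.card := by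
    intro P hP
    by_contra! hle
    obtain ⟨f, hf, hge⟩ := hcon P hP _ (Finset.filter_subset _ _) hle
    obtain ⟨hfG, rfl⟩ := Finset.mem_filter.1 hf
    exact absurd (hc f hfG).2 (not_lt.2 hge)
  obtain ⟨f, hf⟩ := hG
  have hsum : G.card = ∑ P ∈ D, (G.filter fun g => c g = P).card :=
    Finset.card_eq_sum_card_fiberwise fun f hf => (hc f hf).1
  have : D.card * G.card < D.card * G.card := by
    calc D.card * G.card = ∑ P ∈ D, D.card * (G.filter fun g => c g = P).card := by
          rw [← Finset.mul_sum, ← hsum]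
      _ < ∑ _P ∈ D, G.card := Finset.sum_lt_sum_of_nonempty ⟨_, (hc f hf).1⟩ hlt
      _ = D.card * G.card := by simp
  exact lt_irrefl _ this

theorem card_le_of_fiber_le [Fintype α] {G : Finset (ι → α)} {P : Finset ι} {τ : ℕ}
    (h : ∀ f ∈ G, (fiber G P f).card ≤ τ) :
    G.card ≤ τ * Fintype.card α ^ (Fintype.card ι - P.card) := by
  have h1 : G.card ≤ τ * (G.image fun f => fun i : {i // i ∉ P} => f i).card := by
    refine Finset.card_le_mul_card_image G τ ?_
    intro x hx
    obtain ⟨f, hf, rfl⟩ := Finset.mem_image.1 hx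
    have := h f hf
    rwa [fiber_eq_filter_restrict] at this
  refine h1.trans (Nat.mul_le_mul_left _ ?_)
  refine (Finset.card_le_univ _).trans ?_
  rw [Fintype.card_fun, Fintype.card_subtype_compl, Fintype.card_coe]

/-- If the `P`-degrees are at least `κ₁` in `G` and at most `κ` in a subfamily, then the subfamily
has at most a proportion `κ / κ₁` of the tuples. -/
theorem mul_card_le_of_fiber_le {G G' : Finset (ι → α)} {P : Finset ι} {κ κ₁ : ℕ} (hsub : G' ⊆ G)
    (h : ∀ f ∈ G, κ₁ ≤ (fiber G P f).card) (h' : ∀ f ∈ G', (fiber G' P f).card ≤ κ) :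
    κ₁ * G'.card ≤ κ * G.card := by
  have h1 : G'.card ≤ κ * (G'.image fun f => fun i : {i // i ∉ P} => f i).card := by
    refine Finset.card_le_mul_card_image G' κ ?_
    intro x hx
    obtain ⟨f, hf, rfl⟩ := Finset.mem_image.1 hx
    have := h' f hf
    rwa [fiber_eq_filter_restrict] at this
  have h2 : κ₁ * (G.image fun f => fun i : {i // i ∉ P} => f i).card ≤ G.card := by
    refine Finset.mul_card_image_le_card G κ₁ ?_
    intro x hx
    obtain ⟨f, hf, rfl⟩ := Finset.mem_image.1 hx
    have := h f hf
    rwa [fiber_eq_filter_restrict] at this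
  calc κ₁ * G'.card ≤ κ₁ * (κ * (G'.image fun f => fun i : {i // i ∉ P} => f i).card) :=
        Nat.mul_le_mul_left _ h1
    _ ≤ κ₁ * (κ * (G.image fun f => fun i : {i // i ∉ P} => f i).card) := by
        gcongr
    _ = κ * (κ₁ * (G.image fun f => fun i : {i // i ∉ P} => f i).card) := by ring
    _ ≤ κ * G.card := Nat.mul_le_mul_left _ h2

/-- Changing the coordinates in `I` one at a time, with at least `κ` choices for each. -/
theorem pow_le_card_fiber {C : Finset (ι → α)} {κ : ℕ} (I : Finset ι)
    (h : ∀ i ∈ I, ∀ f ∈ C, κ ≤ (fiber C {i} f).card) :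
    ∀ f ∈ C, κ ^ I.card ≤ (fiber C I f).card := by
  induction I using Finset.induction_on with
  | empty =>
    intro f hf
    have : f ∈ fiber C ∅ f := mem_fiber.2 ⟨hf, fun _ _ => rfl⟩
    simpa using Finset.card_pos.2 ⟨f, this⟩
  | insert i I hi ih =>
    intro f hf
    have ih' := ih fun j hj => h j (Finset.mem_insert_of_mem hj)
    have hsub : (fiber C {i} f).biUnion (fiber C I) ⊆ fiber C (insert i I) f := by
      intro x hx
      obtain ⟨g, hg, hx⟩ := Finset.mem_biUnion.1 hx
      rw [mem_fiber] at hg hx ⊢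
      refine ⟨hx.1, fun j hj => ?_⟩
      rw [Finset.mem_insert, not_or] at hj
      rw [hx.2 j hj.2, hg.2 j (by simpa using hj.1)]
    have hdisj : Set.PairwiseDisjoint (fiber C {i} f : Set (ι → α)) (fiber C I) := by
      intro g hg g' hg' hne
      refine Finset.disjoint_left.2 fun x hx hx' => hne ?_
      rw [Finset.mem_coe, mem_fiber] at hg hg'
      rw [mem_fiber] at hx hx'
      funext j
      by_cases hj : j = i
      · subst hj
        rw [← hx.2 j hi, ← hx'.2 j hi]
      · rw [hg.2 j (by simpa using hj), hg'.2 j (by simpa using hj)]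
    rw [Finset.card_insert_of_notMem hi, pow_succ, mul_comm]
    calc κ * κ ^ I.card ≤ (fiber C {i} f).card * κ ^ I.card :=
          Nat.mul_le_mul_right _ (h i (Finset.mem_insert_self _ _) f hf)
      _ ≤ ∑ g ∈ fiber C {i} f, (fiber C I g).card := by
          rw [← smul_eq_mul]
          exact Finset.card_nsmul_le_sum _ _ _ fun g hg => ih' g (mem_fiber.1 hg).1
      _ = ((fiber C {i} f).biUnion (fiber C I)).card := (Finset.card_biUnion hdisj).symm
      _ ≤ _ := Finset.card_le_card hsub

/-- A large family of tuples contains a core in which every coordinate is either *small* (it lies in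
`M` and all degrees in its direction are less than `κ`) or *large* (all degrees in its direction are
at least `κ`), while two coordinates together always have degree at least `K * κ`. A coordinate in
`J` is large provided that subfamilies of small degree in its direction are scarce. -/
theorem exists_uniform_core [Fintype α] (G : Finset (ι → α)) (J : Finset ι) (κ K : ℕ)
    (hJ : ∀ j ∈ J, ∀ G' ⊆ G, (∀ f ∈ G', (fiber G' {j} f).card < κ) →
      (2 ^ Fintype.card ι) ^ (Fintype.card ι + 1) * G'.card < G.card)
    (hG : (2 ^ Fintype.card ι) ^ (Fintype.card ι + 1) *
      (K * κ * Fintype.card α ^ (Fintype.card ι - 2)) < G.card) :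
    ∃ (M : Finset ι) (C : Finset (ι → α)), Disjoint M J ∧ C ⊆ G ∧ C.Nonempty ∧
      (∀ j ∉ M, ∀ f ∈ C, κ ≤ (fiber C {j} f).card) ∧
      (∀ j ∈ M, ∀ f ∈ C, (fiber C {j} f).card < κ) ∧
      ∀ i j, i ≠ j → ∀ f ∈ C, K * κ ≤ (fiber C {i, j} f).card := by
  classical
  set N := 2 ^ Fintype.card ι with hN
  have hN1 : 1 ≤ N := Nat.one_le_two_pow
  let Pr : Finset ι → Prop := fun M => Disjoint M J ∧ ∃ G' ⊆ G, G.card ≤ N ^ M.card * G'.card ∧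
    ∀ j ∈ M, ∀ f ∈ G', (fiber G' {j} f).card < κ
  -- Choose the largest set of coordinates that can be made small simultaneously.
  obtain ⟨M, hM, hmax⟩ := Finset.exists_max_image (Finset.univ.filter Pr) Finset.card
    ⟨∅, Finset.mem_filter.2 ⟨Finset.mem_univ _, Finset.disjoint_empty_left _, G, subset_rfl,
      by simp, by simp⟩⟩
  obtain ⟨-, hMJ, G', hG'G, hcard, hsmall⟩ := Finset.mem_filter.1 hM
  have hG'ne : G'.Nonempty := by
    rw [← Finset.card_pos]
    by_contra h
    have : G'.card = 0 := by omega
    rw [this, mul_zero] at hcard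
    omega
  let D : Finset (Finset ι) := Finset.univ.filter fun P => (∃ j ∉ M, P = {j}) ∨ P.card = 2
  let τ : Finset ι → ℕ := fun P => if P.card = 2 then K * κ else κ
  have hD : D.card ≤ N := by
    refine (Finset.card_le_univ _).trans ?_
    rw [Fintype.card_finset]
  rcases exists_core_or_large_class D τ G' hG'ne with ⟨C, hC, hCne, hdeg⟩ |
    ⟨P, hP, G'', hG'', hcard', hlow⟩
  · refine ⟨M, C, hMJ, hC.trans hG'G, hCne, fun j hj f hf => ?_, fun j hj f hf => ?_,
      fun i j hij f hf => ?_⟩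
    · have := hdeg {j} (Finset.mem_filter.2 ⟨Finset.mem_univ _, Or.inl ⟨j, hj, rfl⟩⟩) f hf
      simpa [τ] using this
    · exact (Finset.card_le_card (fiber_mono hC _ _)).trans_lt (hsmall j hj f (hC hf))
    · have h2 : ({i, j} : Finset ι).card = 2 := Finset.card_pair hij
      have := hdeg {i, j} (Finset.mem_filter.2 ⟨Finset.mem_univ _, Or.inr h2⟩) f hf
      simpa [τ, h2] using this
  · exfalso
    have hle : G.card ≤ N ^ (M.card + 1) * G''.card := by
      calc G.card ≤ N ^ M.card * G'.card := hcard
        _ ≤ N ^ M.card * (N * G''.card) := by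
            refine Nat.mul_le_mul_left _ (hcard'.trans (Nat.mul_le_mul_right _ hD))
        _ = N ^ (M.card + 1) * G''.card := by ring
    have hle' : G.card ≤ N ^ (Fintype.card ι + 1) * G''.card :=
      hle.trans (Nat.mul_le_mul_right _ (Nat.pow_le_pow_right hN1
        (Nat.succ_le_succ (Finset.card_le_univ M))))
    rcases (Finset.mem_filter.1 hP).2 with ⟨j, hj, rfl⟩ | h2
    · have hlow' : ∀ f ∈ G'', (fiber G'' {j} f).card < κ := by simpa [τ] using hlow
      by_cases hjJ : j ∈ J
      · exact absurd (hJ j hjJ G'' (hG''.trans hG'G) hlow') (not_lt.2 hle')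
      · have hin : insert j M ∈ Finset.univ.filter Pr := by
          refine Finset.mem_filter.2 ⟨Finset.mem_univ _, ?_, G'', hG''.trans hG'G, ?_, ?_⟩
          · exact Finset.disjoint_insert_left.2 ⟨hjJ, hMJ⟩
          · rwa [Finset.card_insert_of_notMem hj]
          · intro i hi f hf
            rcases Finset.mem_insert.1 hi with rfl | hi
            · exact hlow' f hf
            · exact (Finset.card_le_card (fiber_mono hG'' _ _)).trans_lt
                (hsmall i hi f (hG'' hf))
        have := hmax _ hin
        rw [Finset.card_insert_of_notMem hj] at this
        omega
    · have hτ : τ P = K * κ := by simp [τ, h2]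
      have := card_le_of_fiber_le (G := G'') (P := P) (τ := K * κ)
        fun f hf => hτ ▸ (hlow f hf).le
      rw [h2] at this
      exact absurd hG (not_lt.2 (hle'.trans (Nat.mul_le_mul_left _ this)))

/-- In a uniform core, the coordinates in a set `B` that does not meet the set `M` of small
coordinates in exactly one element can be moved away from any set `Q` of at most `q` vertices, all
other coordinates being kept: large coordinates are moved one by one, small ones in pairs. -/
theorem exists_refresh {C : Finset (ι → α)} {M B : Finset ι} {κ q : ℕ} (hq : q < κ)
    (hl : ∀ j ∉ M, ∀ f ∈ C, κ ≤ (fiber C {j} f).card)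
    (hs : ∀ j ∈ M, ∀ f ∈ C, (fiber C {j} f).card < κ)
    (hp : ∀ i j, i ≠ j → ∀ f ∈ C, (2 * q + 1) * κ ≤ (fiber C {i, j} f).card)
    (hB : (M ∩ B).card ≠ 1) {Q : Finset α} (hQ : Q.card ≤ q) {f : ι → α} (hf : f ∈ C) :
    ∃ g ∈ C, (∀ i ∉ B, g i = f i) ∧ ∀ i ∈ B, g i ∉ Q := by
  have single : ∀ i ∉ M, ∀ g ∈ C, ∃ g' ∈ C, (∀ j, j ≠ i → g' j = g j) ∧ g' i ∉ Q := by
    intro i hi g hg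
    by_contra! hcon
    have hinj : (fiber C {i} g).card ≤ Q.card := by
      refine Finset.card_le_card_of_injOn (fun g' => g' i) ?_ ?_
      · intro g' hg'
        rw [Finset.mem_coe, mem_fiber] at hg'
        exact hcon g' hg'.1 fun j hj => hg'.2 j (by simpa using hj)
      · intro x hx y hy hxy
        rw [Finset.mem_coe, mem_fiber] at hx hy
        funext j
        by_cases hj : j = i
        · subst hj; exact hxy
        · rw [hx.2 j (by simpa using hj), hy.2 j (by simpa using hj)]
    have := hl i hi g hg
    omega
  have pair : ∀ i ∈ M, ∀ j ∈ M, i ≠ j → ∀ g ∈ C,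
      ∃ g' ∈ C, (∀ l, l ≠ i → l ≠ j → g' l = g l) ∧ g' i ∉ Q ∧ g' j ∉ Q := by
    intro i hi j hj hij g hg
    by_contra! hcon
    -- For a fixed value at one of the two coordinates fewer than `κ` values remain for the other.
    have hfix : ∀ i ∈ M, ∀ j ∈ M, i ≠ j → ∀ z,
        ((fiber C {i, j} g).filter fun g' => g' i = z).card ≤ κ := by
      intro i hi j hj hij z
      rcases ((fiber C {i, j} g).filter fun g' => g' i = z).eq_empty_or_nonempty with h | ⟨x, hx⟩
      · simp [h]
      · rw [Finset.mem_filter, mem_fiber] at hx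
        refine (Finset.card_le_card ?_).trans (hs j hj x hx.1.1).le
        intro y hy
        rw [Finset.mem_filter, mem_fiber] at hy
        refine mem_fiber.2 ⟨hy.1.1, fun l hl => ?_⟩
        have hlj : l ≠ j := by simpa using hl
        by_cases hli : l = i
        · subst hli; rw [hy.2, hx.2]
        · rw [hy.1.2 l (by simp [hli, hlj]), hx.1.2 l (by simp [hli, hlj])]
    have hcover : fiber C {i, j} g ⊆
        (Q.biUnion fun z => (fiber C {i, j} g).filter fun g' => g' i = z) ∪
          Q.biUnion fun z => (fiber C {j, i} g).filter fun g' => g' j = z := by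
      intro x hx
      have hx' := hx
      rw [mem_fiber] at hx'
      by_cases hxi : x i ∈ Q
      · exact Finset.mem_union_left _ (Finset.mem_biUnion.2
          ⟨_, hxi, Finset.mem_filter.2 ⟨hx, rfl⟩⟩)
      · refine Finset.mem_union_right _ (Finset.mem_biUnion.2
          ⟨_, hcon x hx'.1 (fun l h1 h2 => hx'.2 l (by simp [h1, h2])) hxi,
            Finset.mem_filter.2 ⟨?_, rfl⟩⟩)
        rwa [Finset.pair_comm]
    have h1 := Finset.card_le_card hcover
    have h2 : (Q.biUnion fun z => (fiber C {i, j} g).filter fun g' => g' i = z).card ≤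
        Q.card * κ := Finset.card_biUnion_le_card_mul _ _ _ fun z _ => hfix i hi j hj hij z
    have h3 : (Q.biUnion fun z => (fiber C {j, i} g).filter fun g' => g' j = z).card ≤
        Q.card * κ := Finset.card_biUnion_le_card_mul _ _ _ fun z _ => hfix j hj i hi hij.symm z
    have h4 := Finset.card_union_le
      (Q.biUnion fun z => (fiber C {i, j} g).filter fun g' => g' i = z)
      (Q.biUnion fun z => (fiber C {j, i} g).filter fun g' => g' j = z)
    have h5 := hp i j hij g hg
    have h6 : Q.card * κ ≤ q * κ := Nat.mul_le_mul_right _ hQ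
    have h7 : (2 * q + 1) * κ = q * κ + q * κ + κ := by ring
    omega
  have key : ∀ X ⊆ B, ∃ g ∈ C, (∀ i ∉ B, g i = f i) ∧ ∀ i ∈ X, g i ∉ Q := by
    intro X
    induction X using Finset.induction_on with
    | empty => exact fun _ => ⟨f, hf, fun _ _ => rfl, by simp⟩
    | insert i X hi ih =>
      intro hX
      obtain ⟨g, hg, hgB, hgX⟩ := ih ((Finset.subset_insert _ _).trans hX)
      have hiB : i ∈ B := hX (Finset.mem_insert_self _ _)
      by_cases hiM : i ∈ M
      · obtain ⟨j, hj, hji⟩ : ∃ j ∈ M ∩ B, j ≠ i := by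
          have hmem : i ∈ M ∩ B := Finset.mem_inter.2 ⟨hiM, hiB⟩
          have hpos := Finset.card_pos.2 ⟨i, hmem⟩
          exact Finset.exists_mem_ne (by omega) i
        obtain ⟨hjM, hjB⟩ := Finset.mem_inter.1 hj
        obtain ⟨g', hg', h1, h2, h3⟩ := pair i hiM j hjM hji.symm g hg
        refine ⟨g', hg', fun l hl => ?_, fun l hl => ?_⟩
        · rw [h1 l (fun h => hl (h ▸ hiB)) (fun h => hl (h ▸ hjB)), hgB l hl]
        · by_cases hli : l = i
          · exact hli ▸ h2
          · by_cases hlj : l = j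
            · exact hlj ▸ h3
            · rw [h1 l hli hlj]
              exact hgX l (Finset.mem_of_mem_insert_of_ne hl hli)
      · obtain ⟨g', hg', h1, h2⟩ := single i hiM g hg
        refine ⟨g', hg', fun l hl => ?_, fun l hl => ?_⟩
        · rw [h1 l (fun h => hl (h ▸ hiB)), hgB l hl]
        · by_cases hli : l = i
          · exact hli ▸ h2
          · rw [h1 l hli]
            exact hgX l (Finset.mem_of_mem_insert_of_ne hl hli)
  exact key B subset_rfl

end Tuples

/-! ### Blowups in uniform cores -/

section Cores

variable {α : Type*} [Fintype α] [DecidableEq α]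

/-- The edges of `G` with all their orderings, as injective `r`-tuples. -/
def tuples (r : ℕ) (G : Finset (Finset α)) : Finset (Fin r → α) :=
  Finset.univ.filter fun f => Function.Injective f ∧ Finset.univ.image f ∈ G

theorem mem_tuples {r : ℕ} {G : Finset (Finset α)} {f : Fin r → α} :
    f ∈ tuples r G ↔ Function.Injective f ∧ Finset.univ.image f ∈ G := by
  simp [tuples]

theorem exists_mem_tuples {r : ℕ} {G : Finset (Finset α)} (hG : IsUniform G r) {e : Finset α}
    (he : e ∈ G) : ∃ f ∈ tuples r G, Finset.univ.image f = e := by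
  let σ : e ≃ Fin r := Finset.equivFinOfCardEq (hG e he)
  have him : Finset.univ.image (fun i => (σ.symm i : α)) = e := by
    ext x
    simp only [Finset.mem_image, Finset.mem_univ, true_and]
    constructor
    · rintro ⟨i, rfl⟩
      exact (σ.symm i).2
    · intro hx
      exact ⟨σ ⟨x, hx⟩, by simp⟩
  refine ⟨fun i => (σ.symm i : α), mem_tuples.2 ⟨?_, by rwa [him]⟩, him⟩
  exact Subtype.val_injective.comp σ.symm.injective

theorem card_le_card_tuples {r : ℕ} {G : Finset (Finset α)} (hG : IsUniform G r) :
    G.card ≤ (tuples r G).card := by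
  refine (Finset.card_le_card ?_).trans
    (Finset.card_image_le (s := tuples r G) (f := fun f => Finset.univ.image f))
  intro e he
  obtain ⟨f, hf, hfe⟩ := exists_mem_tuples hG he
  exact Finset.mem_image.2 ⟨f, hf, hfe⟩

theorem card_tuples_filter_le {r : ℕ} {G : Finset (Finset α)} (hG : IsUniform G r) (j : Fin r)
    (x : α) : ((tuples r G).filter fun f => f j = x).card ≤
      r ^ r * (G.filter fun e => x ∈ e).card := by
  have hmaps : ∀ f ∈ (tuples r G).filter fun f => f j = x,
      Finset.univ.image f ∈ G.filter fun e => x ∈ e := by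
    intro f hf
    obtain ⟨hfG, rfl⟩ := Finset.mem_filter.1 hf
    exact Finset.mem_filter.2 ⟨(mem_tuples.1 hfG).2, Finset.mem_image_of_mem _ (Finset.mem_univ _)⟩
  refine Finset.card_le_mul_card_image_of_maps_to hmaps _ ?_
  intro e he
  have hcard : (Fintype.piFinset fun _ : Fin r => e).card = r ^ r := by
    rw [Fintype.card_piFinset_const, hG e (Finset.mem_filter.1 he).1]
  rw [← hcard]
  refine Finset.card_le_card fun f hf => ?_
  obtain ⟨-, rfl⟩ := Finset.mem_filter.1 hf
  exact Fintype.mem_piFinset.2 fun i => Finset.mem_image_of_mem _ (Finset.mem_univ _)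

/-- The coordinates split into parts of sizes `a > b`, neither of which meets `M` in exactly one
element. The exception `b = 1` and `M = Fin r` reflects Steiner systems. -/
theorem exists_split {r a b : ℕ} (hb : 0 < b) (hba : b < a) (hr : a + b = r) (M : Finset (Fin r))
    (hM : 2 ≤ M.card) (hM' : b = 1 → M.card < r) :
    ∃ A : Finset (Fin r), A.card = a ∧ (M ∩ A).card ≠ 1 ∧ (M ∩ Aᶜ).card ≠ 1 := by
  by_cases hMa : M.card ≤ a
  · obtain ⟨A, hMA, -, hA⟩ := Finset.exists_subsuperset_card_eq (Finset.subset_univ M) hMa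
      (by simp; omega)
    refine ⟨A, hA, ?_, ?_⟩
    · rw [Finset.inter_eq_left.2 hMA]; omega
    · have : M ∩ Aᶜ = ∅ := by
        rw [← Finset.disjoint_iff_inter_eq_empty]
        exact Finset.disjoint_left.2 fun x hx hx' => (Finset.mem_compl.1 hx') (hMA hx)
      simp [this]
  · obtain ⟨B, hBM, hB⟩ := Finset.exists_subset_card_eq (s := M) (n := b) (by omega)
    have hb2 : 2 ≤ b := by
      by_contra h
      have := hM' (by omega)
      omega
    refine ⟨Bᶜ, ?_, ?_, ?_⟩
    · rw [Finset.card_compl, Fintype.card_fin]; omega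
    · have : M ∩ Bᶜ = M \ B := by ext x; simp
      rw [this, Finset.card_sdiff_of_subset hBM]; omega
    · rw [compl_compl, Finset.inter_eq_right.2 hBM]; omega

/-- If the coordinates in `A` and those outside `A` can both be moved away from any few vertices
inside a family of ordered edges, then the blowup of every tree embeds greedily. -/
theorem containsCopy_of_refresh {r a b s t : ℕ} (hr : a + b = r)
    {T : SimpleGraph (Fin s ⊕ Fin t)} (hT : IsTreeWithParts s t T) {H : Finset (Finset α)}
    {C : Finset (Fin r → α)} (hC : C ⊆ tuples r H) (hne : C.Nonempty) (A : Finset (Fin r))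
    (hA : A.card = a)
    (hmove : ∀ B, B = A ∨ B = Aᶜ → ∀ Q : Finset α, Q.card ≤ (s + t) * r → ∀ f ∈ C,
      ∃ g ∈ C, (∀ i ∉ B, g i = f i) ∧ ∀ i ∈ B, g i ∉ Q) :
    ContainsCopy H (blowup T a b) := by
  classical
  obtain ⟨hT, hbip⟩ := hT
  have hA' : Aᶜ.card = b := by rw [Finset.card_compl, Fintype.card_fin]; omega
  let side : Fin s ⊕ Fin t → Finset (Fin r) := Sum.elim (fun _ => A) (fun _ => Aᶜ)
  have hside : ∀ w, side w = A ∨ side w = Aᶜ := by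
    rintro (i | j)
    · exact Or.inl rfl
    · exact Or.inr rfl
  have hadj : ∀ w w', T.Adj w w' → side w = (side w')ᶜ := by
    intro w w' h
    have := hbip h
    rcases w with i | j <;> rcases w' with i' | j' <;> simp_all [side]
  let P : Fin s ⊕ Fin t → Finset α → Prop := fun w x => ∃ f ∈ C, (side w).image f = x
  have hPcard : ∀ w x, P w x → x.card = (side w).card := by
    rintro w x ⟨f, hf, rfl⟩
    exact Finset.card_image_of_injective _ (mem_tuples.1 (hC hf)).1
  obtain ⟨φ, hφ, hd, hφH⟩ := exists_tree_assignment H _ (Fin s ⊕ Fin t) T P hT rfl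
    (fun w => by
      obtain ⟨f, hf⟩ := hne
      exact ⟨_, f, hf, rfl⟩)
    (by
      intro S φ hP _ w hw w' hw' hww'
      obtain ⟨f, hf, hfw⟩ := hP w hw
      obtain ⟨g, hg, hgf, hgQ⟩ := hmove (side w') (hside w') (S.biUnion φ) (by
        have h1 : S.card ≤ s + t := by
          simpa using Finset.card_le_univ S
        have h2 : (S.biUnion φ).card ≤ S.card * r := by
          refine Finset.card_biUnion_le_card_mul _ _ _ fun u hu => ?_
          rw [hPcard u _ (hP u hu)]
          simpa using Finset.card_le_univ (side u)
        exact h2.trans (Nat.mul_le_mul_right _ h1)) f hf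
      refine ⟨(side w').image g, ⟨g, hg, rfl⟩, ?_, fun u hu => ?_⟩
      · have h1 : (side w).image g = φ w := by
          rw [← hfw]
          refine Finset.image_congr fun i hi => hgf i ?_
          rw [hadj w w' hww'] at hi
          simpa using hi
        rw [← h1, ← Finset.image_union, hadj w w' hww', Finset.union_comm, Finset.union_compl]
        exact (mem_tuples.1 (hC hg)).2
      · refine Finset.disjoint_left.2 fun x hx hx' => ?_
        obtain ⟨i, hi, rfl⟩ := Finset.mem_image.1 hx'
        exact hgQ i hi (Finset.mem_biUnion.2 ⟨u, hu, hx⟩))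
  exact containsCopy_blowup_of_assignment φ (fun i => (hPcard _ _ (hφ _)).trans hA)
    (fun j => (hPcard _ _ (hφ _)).trans hA') hd hφH

/-- A large family of ordered edges of a hypergraph without vertices of high degree yields a copy of
the blowup: its uniform core has at least two small coordinates, since otherwise some vertex would
have degree `κ ^ (r - 1)`. If `b = 1`, some coordinate must be guaranteed to be large. -/
theorem containsCopy_of_card_tuples {r a b s t : ℕ} (hb : 0 < b) (hba : b < a) (hr : a + b = r)
    {T : SimpleGraph (Fin s ⊕ Fin t)} (hT : IsTreeWithParts s t T) {H : Finset (Finset α)}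
    (hH : IsUniform H r) {G : Finset (Fin r → α)} (hGH : G ⊆ tuples r H) {κ : ℕ}
    (hκ : (s + t) * r < κ)
    (hdeg : ∀ x, r ^ r * (H.filter fun e => x ∈ e).card < κ ^ (r - 1))
    (J : Finset (Fin r)) (hJb : b = 1 → J.Nonempty)
    (hJ : ∀ j ∈ J, ∀ G' ⊆ G, (∀ f ∈ G', (fiber G' {j} f).card < κ) →
      (2 ^ r) ^ (r + 1) * G'.card < G.card)
    (hG : (2 ^ r) ^ (r + 1) * ((2 * ((s + t) * r) + 1) * κ * Fintype.card α ^ (r - 2)) < G.card) :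
    ContainsCopy H (blowup T a b) := by
  obtain ⟨M, C, hMJ, hCG, hne, hl, hs, hp⟩ := exists_uniform_core G J κ (2 * ((s + t) * r) + 1)
    (by simpa using hJ) (by simpa using hG)
  have hM2 : 2 ≤ M.card := by
    by_contra hlt
    obtain ⟨j, hj⟩ : ∃ j : Fin r, M ⊆ {j} := by
      rcases M.eq_empty_or_nonempty with rfl | ⟨j, hj⟩
      · exact ⟨⟨0, by omega⟩, Finset.empty_subset _⟩
      · exact ⟨j, fun i hi => Finset.mem_singleton.2
          (Finset.card_le_one.1 (by omega) i hi j hj)⟩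
    obtain ⟨f, hf⟩ := hne
    have h1 := pow_le_card_fiber (C := C) (κ := κ) (Finset.univ.erase j) (fun i hi g hg =>
      hl i (fun hiM => Finset.ne_of_mem_erase hi (Finset.mem_singleton.1 (hj hiM))) g hg) f hf
    rw [Finset.card_erase_of_mem (Finset.mem_univ _), Finset.card_univ, Fintype.card_fin] at h1
    have h2 : (fiber C (Finset.univ.erase j) f).card ≤
        ((tuples r H).filter fun g => g j = f j).card := by
      refine Finset.card_le_card fun g hg => ?_
      rw [mem_fiber] at hg
      exact Finset.mem_filter.2 ⟨hGH (hCG hg.1), hg.2 j (by simp)⟩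
    have h3 := card_tuples_filter_le hH j (f j)
    have h4 := hdeg (f j)
    omega
  obtain ⟨A, hA, h1, h2⟩ := exists_split hb hba hr M hM2 (by
    intro hb1
    obtain ⟨j, hj⟩ := hJb hb1
    have hjM : j ∉ M := Finset.disjoint_right.1 hMJ hj
    have := Finset.card_lt_univ_of_notMem hjM
    rwa [Fintype.card_fin] at this)
  refine containsCopy_of_refresh hr hT (hCG.trans hGH) hne A hA ?_
  rintro B (rfl | rfl) Q hQ f hf
  · exact exists_refresh hκ hl hs hp h1 hQ hf
  · exact exists_refresh hκ hl hs hp h2 hQ hf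

/-- For `b ≥ 2`, a blowup-free hypergraph without vertices of high degree has few edges. -/
theorem card_le_of_two_le {r a b s t : ℕ} (hb : 2 ≤ b) (hba : b < a) (hr : a + b = r)
    {T : SimpleGraph (Fin s ⊕ Fin t)} (hT : IsTreeWithParts s t T) {H : Finset (Finset α)}
    (hH : IsUniform H r) {κ : ℕ} (hκ : (s + t) * r < κ)
    (hdeg : ∀ x, r ^ r * (H.filter fun e => x ∈ e).card < κ ^ (r - 1))
    (hfree : ¬ ContainsCopy H (blowup T a b)) :
    H.card ≤ (2 ^ r) ^ (r + 1) * ((2 * ((s + t) * r) + 1) * κ * Fintype.card α ^ (r - 2)) := by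
  by_contra! hlt
  exact hfree (containsCopy_of_card_tuples (by omega) hba hr hT hH subset_rfl hκ hdeg ∅
    (by omega) (by simp) (hlt.trans_le (card_le_card_tuples hH)))

/-- The edges of `H` all of whose `(r - 1)`-subsets have degree less than `κ` in `H`. -/
def lowEdges (r κ : ℕ) (H : Finset (Finset α)) : Finset (Finset α) :=
  H.filter fun e => ∀ f ∈ tuples r H, Finset.univ.image f = e →
    ∀ j, (fiber (tuples r H) {j} f).card < κ

/-- For `b = 1`, a blowup-free hypergraph without vertices of high degree has few edges that contain
an `(r - 1)`-set of large degree. -/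
theorem card_sdiff_lowEdges_le {r a s t : ℕ} (ha : 1 < a) (hr : a + 1 = r)
    {T : SimpleGraph (Fin s ⊕ Fin t)} (hT : IsTreeWithParts s t T) {H : Finset (Finset α)}
    (hH : IsUniform H r) {κ : ℕ} (hκ : (s + t) * r < κ)
    (hdeg : ∀ x, r ^ r * (H.filter fun e => x ∈ e).card < κ ^ (r - 1))
    (hfree : ¬ ContainsCopy H (blowup T a 1)) :
    (H \ lowEdges r (((2 ^ r) ^ (r + 1) + 1) * κ) H).card ≤
      r * ((2 ^ r) ^ (r + 1) * ((2 * ((s + t) * r) + 1) * κ * Fintype.card α ^ (r - 2))) := by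
  set c := (2 ^ r) ^ (r + 1) with hc
  let G : Fin r → Finset (Fin r → α) := fun j =>
    (tuples r H).filter fun f => (c + 1) * κ ≤ (fiber (tuples r H) {j} f).card
  have hfib : ∀ j, ∀ f ∈ G j, fiber (tuples r H) {j} f ⊆ fiber (G j) {j} f := by
    intro j f hf g hg
    rw [mem_fiber] at hg
    refine mem_fiber.2 ⟨Finset.mem_filter.2 ⟨hg.1, ?_⟩, hg.2⟩
    rw [fiber_congr _ hg.2]
    exact (Finset.mem_filter.1 hf).2
  have hGj : ∀ j, (G j).card ≤
      c * ((2 * ((s + t) * r) + 1) * κ * Fintype.card α ^ (r - 2)) := by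
    intro j
    by_contra! hlt
    refine hfree (containsCopy_of_card_tuples one_pos ha hr hT hH (Finset.filter_subset _ _) hκ hdeg
      {j} (fun _ => Finset.singleton_nonempty j) ?_ hlt)
    intro i hi G' hG' hlow
    obtain rfl := Finset.mem_singleton.1 hi
    have h1 : (c + 1) * κ * G'.card ≤ κ * (G i).card :=
      mul_card_le_of_fiber_le hG' (fun f hf => (Finset.mem_filter.1 hf).2.trans
        (Finset.card_le_card (hfib i f hf))) (fun f hf => (hlow f hf).le)
    have h2 : (c + 1) * G'.card ≤ (G i).card := by
      have hκ0 : 0 < κ := by omega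
      refine Nat.le_of_mul_le_mul_left ?_ hκ0
      calc κ * ((c + 1) * G'.card) = (c + 1) * κ * G'.card := by ring
        _ ≤ _ := h1
    have h3 : (c + 1) * G'.card = c * G'.card + G'.card := by ring
    have h4 : 0 < (G i).card := (Nat.zero_le _).trans_lt hlt
    rcases Nat.eq_zero_or_pos G'.card with h0 | h0
    · rwa [h0, mul_zero]
    · change c * G'.card < (G i).card
      omega
  have hsub : H \ lowEdges r ((c + 1) * κ) H ⊆
      Finset.univ.biUnion fun j => (G j).image fun f => Finset.univ.image f := by
    intro e he
    simp only [lowEdges, Finset.mem_sdiff, Finset.mem_filter, not_and, not_forall, not_lt] at he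
    obtain ⟨heH, he⟩ := he
    obtain ⟨f, hf, hfe, j, hj⟩ := he heH
    exact Finset.mem_biUnion.2 ⟨j, Finset.mem_univ _, Finset.mem_image.2
      ⟨f, Finset.mem_filter.2 ⟨hf, hj⟩, hfe⟩⟩
  refine (Finset.card_le_card hsub).trans ?_
  refine (Finset.card_biUnion_le_card_mul _ _ _
    fun j _ => Finset.card_image_le.trans (hGj j)).trans ?_
  simp

/-- Two vertices lie in few common edges that have all `(r - 1)`-subsets of low degree. -/
theorem card_lowEdges_filter_pair_le {r κ : ℕ} (hr : 3 ≤ r) {H : Finset (Finset α)}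
    (hH : IsUniform H r) {v z : α} (hvz : v ≠ z) :
    ((lowEdges r κ H).filter fun e => v ∈ e ∧ z ∈ e).card ≤
      r * r * (κ * Fintype.card α ^ (r - 3)) := by
  let G : Fin r × Fin r → Finset (Fin r → α) := fun p =>
    (tuples r (lowEdges r κ H)).filter fun f => f p.1 = v ∧ f p.2 = z
  have hlow : IsUniform (lowEdges r κ H) r := fun e he => hH e (Finset.mem_filter.1 he).1
  have hGp : ∀ p, (G p).card ≤ κ * Fintype.card α ^ (r - 3) := by
    rintro ⟨i, j⟩
    rcases eq_or_ne i j with rfl | hij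
    · have : G (i, i) = ∅ := by
        refine Finset.filter_eq_empty_iff.2 ?_
        rintro f - ⟨h1, h2⟩
        exact hvz (h1.symm.trans h2)
      simp [this]
    obtain ⟨l, hl⟩ : ∃ l : Fin r, l ∉ ({i, j} : Finset (Fin r)) := by
      by_contra! hcon
      have h1 : (Finset.univ : Finset (Fin r)) ⊆ {i, j} := fun x _ => hcon x
      have h2 := Finset.card_le_card h1
      rw [Finset.card_univ, Fintype.card_fin, Finset.card_pair hij] at h2
      omega
    have hcard : ({l, i, j} : Finset (Fin r)).card = 3 := by
      rw [Finset.card_insert_of_notMem hl, Finset.card_pair hij]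
    have := card_le_of_fiber_le (G := G (i, j)) (P := {l, i, j}) (τ := κ) (by
      intro f hf
      obtain ⟨hf1, hfi, hfj⟩ := Finset.mem_filter.1 hf
      have hfH := (Finset.mem_filter.1 (mem_tuples.1 hf1).2)
      refine le_trans (Finset.card_le_card ?_)
        (hfH.2 f (mem_tuples.2 ⟨(mem_tuples.1 hf1).1, hfH.1⟩) rfl l).le
      intro g hg
      rw [mem_fiber] at hg
      obtain ⟨hg1, hgi, hgj⟩ := Finset.mem_filter.1 hg.1
      have hgH := (Finset.mem_filter.1 (mem_tuples.1 hg1).2)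
      refine mem_fiber.2 ⟨mem_tuples.2 ⟨(mem_tuples.1 hg1).1, hgH.1⟩, fun m hm => ?_⟩
      simp only at hfi hfj hgi hgj
      by_cases hmi : m = i
      · rw [hmi, hgi, hfi]
      · by_cases hmj : m = j
        · rw [hmj, hgj, hfj]
        · exact hg.2 m (by simp [hmi, hmj, Finset.mem_singleton.not.1 hm]))
    rwa [hcard, Fintype.card_fin] at this
  have hsub : ((lowEdges r κ H).filter fun e => v ∈ e ∧ z ∈ e) ⊆
      Finset.univ.biUnion fun p => (G p).image fun f => Finset.univ.image f := by
    intro e he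
    obtain ⟨he, hv, hz⟩ := Finset.mem_filter.1 he
    obtain ⟨f, hf, rfl⟩ := exists_mem_tuples hlow he
    obtain ⟨i, -, hi⟩ := Finset.mem_image.1 hv
    obtain ⟨j, -, hj⟩ := Finset.mem_image.1 hz
    exact Finset.mem_biUnion.2 ⟨(i, j), Finset.mem_univ _, Finset.mem_image.2
      ⟨f, Finset.mem_filter.2 ⟨hf, hi, hj⟩, rfl⟩⟩
  refine (Finset.card_le_card hsub).trans ?_
  refine (Finset.card_biUnion_le_card_mul _ _ _
    fun p _ => Finset.card_image_le.trans (hGp p)).trans ?_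
  simp

end Cores

/-! ### The bipartite incidence between `(r - 1)`-sets and vertices -/

section Incidence

variable {α : Type*} [DecidableEq α]

/-- The pairs of `E` with first component `S`, for a set `E` of pairs `(S, v)` representing edges
`S ∪ {v}`. -/
def starOf (E : Finset (Finset α × α)) (S : Finset α) : Finset (Finset α × α) :=
  E.filter fun p => p.1 = S

/-- The pairs of `E` with second component `v`. -/
def linkOf (E : Finset (Finset α × α)) (v : α) : Finset (Finset α × α) :=
  E.filter fun p => p.2 = v

/-- The number of pairs in `E`, counting only those in excess of the first `k` pairs for each first
component. -/
def excess [Fintype α] (k : ℕ) (E : Finset (Finset α × α)) : ℕ :=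
  ∑ S : Finset α, ((starOf E S).card - k)

/-- If the excess is larger than the total threshold of the vertices, there is a nonempty subset in
which all first components have degree more than `k` and all second components have degree above
their threshold: deleting a first component of low degree leaves the excess unchanged, and deleting
a vertex below its threshold decreases the excess by at most that threshold. -/
theorem exists_excess_core [Fintype α] (k : ℕ) (τ : α → ℕ) (E : Finset (Finset α × α))
    (hE : ∑ v ∈ E.image Prod.snd, τ v < excess k E) :
    ∃ E' ⊆ E, E'.Nonempty ∧ ∀ p ∈ E', k < (starOf E' p.1).card ∧ τ p.2 < (linkOf E' p.2).card := by
  induction E using Finset.strongInduction with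
  | H E ih =>
    by_cases hgood : ∀ p ∈ E, k < (starOf E p.1).card ∧ τ p.2 < (linkOf E p.2).card
    · refine ⟨E, subset_rfl, ?_, hgood⟩
      rw [Finset.nonempty_iff_ne_empty]
      rintro rfl
      simp [excess, starOf] at hE
    · push Not at hgood
      obtain ⟨p, hp, hpd⟩ := hgood
      by_cases hk : k < (starOf E p.1).card
      · have hτ := hpd hk
        set E₂ := E.filter fun q => q.2 ≠ p.2 with hE₂
        have hss : E₂ ⊂ E := Finset.filter_ssubset.2 ⟨p, hp, by simp⟩
        have hex : excess k E ≤ excess k E₂ + (linkOf E p.2).card := by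
          have hlink : (linkOf E p.2).card =
              ∑ S : Finset α, ((linkOf E p.2).filter fun q => q.1 = S).card :=
            Finset.card_eq_sum_card_fiberwise fun _ _ => Finset.mem_coe.2 (Finset.mem_univ _)
          rw [hlink, excess, excess, ← Finset.sum_add_distrib]
          refine Finset.sum_le_sum fun S _ => ?_
          have hsub : starOf E S ⊆ starOf E₂ S ∪ (linkOf E p.2).filter fun q => q.1 = S := by
            intro q hq
            obtain ⟨hq, hqS⟩ := Finset.mem_filter.1 hq
            by_cases hqp : q.2 = p.2
            · exact Finset.mem_union_right _
                (Finset.mem_filter.2 ⟨Finset.mem_filter.2 ⟨hq, hqp⟩, hqS⟩)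
            · exact Finset.mem_union_left _
                (Finset.mem_filter.2 ⟨Finset.mem_filter.2 ⟨hq, hqp⟩, hqS⟩)
          have h1 := Finset.card_le_card hsub
          have h2 := Finset.card_union_le (starOf E₂ S) ((linkOf E p.2).filter fun q => q.1 = S)
          omega
        have hsum : ∑ v ∈ E₂.image Prod.snd, τ v + τ p.2 ≤ ∑ v ∈ E.image Prod.snd, τ v := by
          have hnot : p.2 ∉ E₂.image Prod.snd := by
            rw [Finset.mem_image]
            rintro ⟨q, hq, hqp⟩
            exact (Finset.mem_filter.1 hq).2 hqp
          rw [add_comm, ← Finset.sum_insert hnot]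
          refine Finset.sum_le_sum_of_subset ?_
          refine Finset.insert_subset (Finset.mem_image_of_mem _ hp) ?_
          exact Finset.image_subset_image hss.subset
        obtain ⟨E', h1, h2⟩ := ih E₂ hss (by omega)
        exact ⟨E', h1.trans hss.subset, h2⟩
      · set E₂ := E.filter fun q => q.1 ≠ p.1 with hE₂
        have hss : E₂ ⊂ E := Finset.filter_ssubset.2 ⟨p, hp, by simp⟩
        have hex : excess k E ≤ excess k E₂ := by
          refine Finset.sum_le_sum fun S _ => ?_
          by_cases hS : S = p.1
          · subst hS; omega
          · have : starOf E S ⊆ starOf E₂ S := by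
              intro q hq
              obtain ⟨hq, hqS⟩ := Finset.mem_filter.1 hq
              exact Finset.mem_filter.2 ⟨Finset.mem_filter.2 ⟨hq, hqS ▸ hS⟩, hqS⟩
            exact Nat.sub_le_sub_right (Finset.card_le_card this) _
        have hsum : ∑ v ∈ E₂.image Prod.snd, τ v ≤ ∑ v ∈ E.image Prod.snd, τ v :=
          Finset.sum_le_sum_of_subset (Finset.image_subset_image hss.subset)
        obtain ⟨E', h1, h2⟩ := ih E₂ hss (by omega)
        exact ⟨E', h1.trans hss.subset, h2⟩

/-- A random bipartition of the vertices, the first components lying on one side and the vertices on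
the other, keeps a constant proportion of the excess. -/
theorem exists_bipartition [Fintype α] (a k : ℕ) (E : Finset (Finset α × α))
    (hcard : ∀ p ∈ E, p.1.card = a) (hnot : ∀ p ∈ E, p.2 ∉ p.1) :
    ∃ X : Finset α, excess k E ≤
      2 ^ (a + (k + 1)) * excess k (E.filter fun p => p.1 ⊆ X ∧ p.2 ∉ X) := by
  classical
  -- Reserve `k` neighbours of each first component; the remaining pairs make up the excess.
  have hR : ∀ S : Finset α, ∃ R ⊆ (starOf E S).image Prod.snd,
      R.card = min k (starOf E S).card := by
    intro S
    refine Finset.exists_subset_card_eq ?_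
    rw [Finset.card_image_of_injOn]
    · exact min_le_right _ _
    · intro p hp q hq hpq
      rw [Finset.mem_coe, starOf, Finset.mem_filter] at hp hq
      exact Prod.ext (hp.2.trans hq.2.symm) hpq
  choose R hRsub hRcard using hR
  let I := E.filter fun p => p.2 ∉ R p.1
  let good : Finset α → Finset (Finset α × α) := fun X =>
    I.filter fun p => p.1 ⊆ X ∧ X ⊆ (insert p.2 (R p.1))ᶜ
  have hstarI : ∀ S, (starOf E S).card = (I.filter fun p => p.1 = S).card + (R S).card := by
    intro S
    have hRimg : ((starOf E S).filter fun p => p.2 ∈ R S).card = (R S).card := by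
      refine Finset.card_bij (fun p _ => p.2) ?_ ?_ ?_
      · intro p hp
        exact (Finset.mem_filter.1 hp).2
      · intro p hp q hq hpq
        have h1 := (Finset.mem_filter.1 (Finset.mem_filter.1 hp).1).2
        have h2 := (Finset.mem_filter.1 (Finset.mem_filter.1 hq).1).2
        exact Prod.ext (h1.trans h2.symm) hpq
      · intro v hv
        obtain ⟨p, hp, rfl⟩ := Finset.mem_image.1 (hRsub S hv)
        exact ⟨p, Finset.mem_filter.2 ⟨hp, hv⟩, rfl⟩
    have hI : (I.filter fun p => p.1 = S) = (starOf E S).filter fun p => p.2 ∉ R S := by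
      ext p
      simp only [I, starOf, Finset.mem_filter]
      constructor
      · rintro ⟨⟨h1, h2⟩, rfl⟩
        exact ⟨⟨h1, rfl⟩, h2⟩
      · rintro ⟨⟨h1, rfl⟩, h2⟩
        exact ⟨⟨h1, h2⟩, rfl⟩
    rw [hI, ← hRimg, add_comm]
    exact (Finset.card_filter_add_card_filter_not _).symm
  have hIcard : excess k E = I.card := by
    rw [Finset.card_eq_sum_card_fiberwise (t := Finset.univ) (f := Prod.fst)
      fun _ _ => Finset.mem_coe.2 (Finset.mem_univ _), excess]
    refine Finset.sum_congr rfl fun S _ => ?_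
    have h1 := hstarI S
    have h2 := hRcard S
    omega
  have hgood : ∀ X, (good X).card ≤ excess k (E.filter fun p => p.1 ⊆ X ∧ p.2 ∉ X) := by
    intro X
    rw [Finset.card_eq_sum_card_fiberwise (t := Finset.univ) (f := Prod.fst)
      fun _ _ => Finset.mem_coe.2 (Finset.mem_univ _), excess]
    refine Finset.sum_le_sum fun S _ => ?_
    rcases ((good X).filter fun p => p.1 = S).eq_empty_or_nonempty with h | ⟨p, hp⟩
    · simp [h]
    obtain ⟨hpg, rfl⟩ := Finset.mem_filter.1 hp
    obtain ⟨hpI, hpX, hXp⟩ := Finset.mem_filter.1 hpg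
    have hXR : ∀ v ∈ R p.1, v ∉ X := fun v hv hvX =>
      Finset.mem_compl.1 (hXp hvX) (Finset.mem_insert_of_mem hv)
    have hk : (R p.1).card = k := by
      have h1 := hstarI p.1
      have h2 := hRcard p.1
      have h3 : 0 < (I.filter fun q => q.1 = p.1).card :=
        Finset.card_pos.2 ⟨p, Finset.mem_filter.2 ⟨hpI, rfl⟩⟩
      omega
    have hsub : ((good X).filter fun q => q.1 = p.1).image Prod.snd ∪ R p.1 ⊆
        (starOf (E.filter fun p => p.1 ⊆ X ∧ p.2 ∉ X) p.1).image Prod.snd := by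
      intro v hv
      rcases Finset.mem_union.1 hv with hv | hv
      · obtain ⟨q, hq, rfl⟩ := Finset.mem_image.1 hv
        obtain ⟨hq, hqp⟩ := Finset.mem_filter.1 hq
        obtain ⟨hqI, hqX, hXq⟩ := Finset.mem_filter.1 hq
        refine Finset.mem_image_of_mem _ (Finset.mem_filter.2 ⟨Finset.mem_filter.2
          ⟨(Finset.mem_filter.1 hqI).1, hqX, fun h => ?_⟩, hqp⟩)
        exact Finset.mem_compl.1 (hXq h) (Finset.mem_insert_self _ _)
      · obtain ⟨q, hq, rfl⟩ := Finset.mem_image.1 (hRsub _ hv)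
        obtain ⟨hq, hqp⟩ := Finset.mem_filter.1 hq
        exact Finset.mem_image_of_mem _ (Finset.mem_filter.2 ⟨Finset.mem_filter.2
          ⟨hq, hqp ▸ hpX, hXR _ hv⟩, hqp⟩)
    have hdisj : Disjoint (((good X).filter fun q => q.1 = p.1).image Prod.snd) (R p.1) := by
      refine Finset.disjoint_left.2 fun v hv hvR => ?_
      obtain ⟨q, hq, rfl⟩ := Finset.mem_image.1 hv
      obtain ⟨hq, hqp⟩ := Finset.mem_filter.1 hq
      exact (Finset.mem_filter.1 (Finset.mem_filter.1 hq).1).2 (hqp ▸ hvR)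
    have h1 := Finset.card_le_card hsub
    rw [Finset.card_union_of_disjoint hdisj, hk, Finset.card_image_of_injOn] at h1
    · have h2 := h1.trans Finset.card_image_le
      omega
    · intro q hq q' hq' hqq
      have h1 := (Finset.mem_filter.1 hq).2
      have h2 := (Finset.mem_filter.1 hq').2
      exact Prod.ext (h1.trans h2.symm) hqq
  have hcount : ∀ p ∈ I, 2 ^ Fintype.card α ≤ 2 ^ (a + (k + 1)) *
      (Finset.univ.filter fun X : Finset α => p.1 ⊆ X ∧ X ⊆ (insert p.2 (R p.1))ᶜ).card := by
    intro p hp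
    have hpE := (Finset.mem_filter.1 hp).1
    have hsub : p.1 ⊆ (insert p.2 (R p.1))ᶜ := by
      intro x hx
      rw [Finset.mem_compl, Finset.mem_insert, not_or]
      refine ⟨fun h => hnot p hpE (h ▸ hx), fun h => ?_⟩
      obtain ⟨q, hq, rfl⟩ := Finset.mem_image.1 (hRsub _ h)
      obtain ⟨hq, hqp⟩ := Finset.mem_filter.1 hq
      exact hnot q hq (hqp ▸ hx)
    have hIcc : (Finset.univ.filter fun X : Finset α => p.1 ⊆ X ∧ X ⊆ (insert p.2 (R p.1))ᶜ) =
        Finset.Icc p.1 (insert p.2 (R p.1))ᶜ := by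
      ext X
      simp [Finset.mem_Icc]
    rw [hIcc, Finset.card_Icc_finset hsub, ← pow_add]
    refine Nat.pow_le_pow_right (by norm_num) ?_
    have h1 := Finset.card_insert_le p.2 (R p.1)
    have h2 := hRcard p.1
    have h3 := hcard p hpE
    have h4 := Finset.card_compl (insert p.2 (R p.1))
    have h5 : (R p.1).card ≤ k := h2.trans_le (min_le_left _ _)
    omega
  by_contra! hcon
  have hlt : ∀ X, 2 ^ (a + (k + 1)) * (good X).card < I.card := fun X => by
    rw [← hIcard]
    exact (Nat.mul_le_mul_left _ (hgood X)).trans_lt (hcon X)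
  have hdouble : ∑ X : Finset α, (good X).card = ∑ p ∈ I,
      (Finset.univ.filter fun X : Finset α => p.1 ⊆ X ∧ X ⊆ (insert p.2 (R p.1))ᶜ).card := by
    simp only [good, Finset.card_filter]
    exact Finset.sum_comm
  have h1 : 2 ^ Fintype.card α * I.card ≤ ∑ X : Finset α, 2 ^ (a + (k + 1)) * (good X).card := by
    rw [← Finset.mul_sum, hdouble, Finset.mul_sum, mul_comm, ← smul_eq_mul]
    exact Finset.card_nsmul_le_sum _ _ _ hcount
  have h2 : ∑ X : Finset α, 2 ^ (a + (k + 1)) * (good X).card < 2 ^ Fintype.card α * I.card := by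
    refine (Finset.sum_lt_sum_of_nonempty Finset.univ_nonempty fun X _ => hlt X).trans_eq ?_
    simp
  omega

/-- A tree is embedded greedily into the incidence between `(r - 1)`-sets and vertices if every set
has at least `t` neighbours and every vertex has many neighbouring sets, few of which contain any
other given vertex. The two sides use disjoint sets of vertices. -/
theorem containsCopy_of_incidence {a s t : ℕ} {T : SimpleGraph (Fin s ⊕ Fin t)}
    (hT : IsTreeWithParts s t T) {H : Finset (Finset α)} {E : Finset (Finset α × α)}
    (hne : E.Nonempty) (X : Finset α) (hX : ∀ p ∈ E, p.1 ⊆ X ∧ p.2 ∉ X)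
    (hcard : ∀ p ∈ E, p.1.card = a) (hH : ∀ p ∈ E, insert p.2 p.1 ∈ H) (η : α → ℕ)
    (hη : ∀ v z, ((linkOf E v).filter fun p => z ∈ p.1).card ≤ η v)
    (hstar : ∀ p ∈ E, t ≤ (starOf E p.1).card)
    (hlink : ∀ p ∈ E, (s + t) * (a + 1) * η p.2 < (linkOf E p.2).card) :
    ContainsCopy H (blowup T a 1) := by
  classical
  obtain ⟨hT, hbip⟩ := hT
  let P : Fin s ⊕ Fin t → Finset α → Prop :=
    Sum.elim (fun _ x => ∃ p ∈ E, p.1 = x) (fun _ x => ∃ p ∈ E, {p.2} = x)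
  have hPl : ∀ i x, P (Sum.inl i) x → x.card = a := by
    rintro i x ⟨p, hp, rfl⟩
    exact hcard p hp
  have hPr : ∀ j x, P (Sum.inr j) x → x.card = 1 := by
    rintro j x ⟨p, hp, rfl⟩
    simp
  obtain ⟨φ, hφ, hd, hφH⟩ := exists_tree_assignment H _ (Fin s ⊕ Fin t) T P hT rfl
    (fun w => by
      obtain ⟨p, hp⟩ := hne
      rcases w with i | j
      · exact ⟨_, p, hp, rfl⟩
      · exact ⟨_, p, hp, rfl⟩)
    (by
      intro S φ hP _ w hw w' hw' hww'
      have hbww := hbip hww'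
      rcases w with i | j <;> rcases w' with i' | j'
      · simp at hbww
      · obtain ⟨p, hp, hpw⟩ := hP _ hw
        -- At most `t - 1` neighbours are occupied by right vertices, none by left vertices.
        let V := (Finset.univ.filter fun l : Fin t => Sum.inr l ∈ S).biUnion fun l =>
          φ (Sum.inr l)
        have hV : V.card < t := by
          have h1 : (Finset.univ.filter fun l : Fin t => Sum.inr l ∈ S).card < t := by
            have := Finset.card_lt_univ_of_notMem
              (s := Finset.univ.filter fun l : Fin t => Sum.inr l ∈ S) (x := j') (by simpa using hw')
            rwa [Fintype.card_fin] at this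
          refine (Finset.card_biUnion_le_card_mul _ _ 1 fun l hl => ?_).trans_lt (by simpa using h1)
          exact (hPr l _ (hP _ (Finset.mem_filter.1 hl).2)).le
        have hN : ((starOf E p.1).image Prod.snd).card = (starOf E p.1).card := by
          refine Finset.card_image_of_injOn fun q hq q' hq' hqq => ?_
          have h1 := (Finset.mem_filter.1 hq).2
          have h2 := (Finset.mem_filter.1 hq').2
          exact Prod.ext (h1.trans h2.symm) hqq
        obtain ⟨v, hv, hvV⟩ := Finset.exists_mem_notMem_of_card_lt_card
          (s := V) (t := (starOf E p.1).image Prod.snd)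
          (by rw [hN]; exact hV.trans_le (hstar p hp))
        obtain ⟨q, hq, rfl⟩ := Finset.mem_image.1 hv
        obtain ⟨hqE, hqp⟩ := Finset.mem_filter.1 hq
        refine ⟨{q.2}, ⟨q, hqE, rfl⟩, ?_, ?_⟩
        · rw [← hpw, ← hqp, Finset.union_comm, ← Finset.insert_eq]
          exact hH q hqE
        · intro u hu
          rw [Finset.disjoint_singleton_right]
          rcases u with l | l
          · obtain ⟨p', hp', hpu⟩ := hP _ hu
            rw [← hpu]
            exact fun h => (hX q hqE).2 ((hX p' hp').1 h)
          · exact fun h => hvV (Finset.mem_biUnion.2 ⟨l, by simpa using hu, h⟩)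
      · obtain ⟨p, hp, hpw⟩ := hP _ hw
        have hQ : (S.biUnion φ).card ≤ (s + t) * (a + 1) := by
          have h1 : S.card ≤ s + t := by simpa using Finset.card_le_univ S
          refine (Finset.card_biUnion_le_card_mul _ _ (a + 1) fun u hu => ?_).trans
            (Nat.mul_le_mul_right _ h1)
          rcases u with l | l
          · exact (hPl l _ (hP _ hu)).trans_le (Nat.le_succ a)
          · exact (hPr l _ (hP _ hu)).trans_le (Nat.succ_le_succ (Nat.zero_le a))
        obtain ⟨q, hq, hqQ⟩ : ∃ q ∈ linkOf E p.2, Disjoint (S.biUnion φ) q.1 := by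
          by_contra! hcon
          have hsub : linkOf E p.2 ⊆
              (S.biUnion φ).biUnion fun z => (linkOf E p.2).filter fun q => z ∈ q.1 := by
            intro q hq
            obtain ⟨z, hz, hzq⟩ := Finset.not_disjoint_iff.1 (hcon q hq)
            exact Finset.mem_biUnion.2 ⟨z, hz, Finset.mem_filter.2 ⟨hq, hzq⟩⟩
          have h1 := (Finset.card_le_card hsub).trans
            (Finset.card_biUnion_le_card_mul _ _ _ fun z _ => hη p.2 z)
          have h2 := hlink p hp
          have h3 := Nat.mul_le_mul_right (η p.2) hQ
          omega
        obtain ⟨hqE, hqp⟩ := Finset.mem_filter.1 hq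
        refine ⟨q.1, ⟨q, hqE, rfl⟩, ?_, fun u hu => ?_⟩
        · rw [← hpw, ← hqp, ← Finset.insert_eq]
          exact hH q hqE
        · exact Finset.disjoint_of_subset_left (Finset.subset_biUnion_of_mem φ hu) hqQ
      · simp at hbww)
  exact containsCopy_blowup_of_assignment φ (fun i => hPl _ _ (hφ _)) (fun j => hPr _ _ (hφ _)) hd hφH

/-- In a blowup-free hypergraph, the incidence between `(r - 1)`-sets and vertices has at most
`t - 1` pairs per set on average, up to an error controlled by the codegrees `η`. -/
theorem card_incidence_le [Fintype α] {a s t : ℕ} (ht : 0 < t) {T : SimpleGraph (Fin s ⊕ Fin t)}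
    (hT : IsTreeWithParts s t T) {H : Finset (Finset α)} {E : Finset (Finset α × α)}
    (hcard : ∀ p ∈ E, p.1.card = a) (hnot : ∀ p ∈ E, p.2 ∉ p.1)
    (hH : ∀ p ∈ E, insert p.2 p.1 ∈ H) (η : α → ℕ)
    (hη : ∀ v z, ((linkOf E v).filter fun p => z ∈ p.1).card ≤ η v)
    (hfree : ¬ ContainsCopy H (blowup T a 1)) :
    E.card ≤ (t - 1) * (Fintype.card α).choose a +
      2 ^ (a + t) * ((s + t) * (a + 1) * ∑ v, η v) := by
  have hexc : excess (t - 1) E ≤ 2 ^ (a + t) * ((s + t) * (a + 1) * ∑ v, η v) := by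
    obtain ⟨X, hX⟩ := exists_bipartition a (t - 1) E hcard hnot
    rw [Nat.sub_add_cancel ht] at hX
    refine hX.trans (Nat.mul_le_mul_left _ ?_)
    by_contra! hlt
    obtain ⟨E', hE', hne, hdeg⟩ := exists_excess_core (t - 1)
      (fun v => (s + t) * (a + 1) * η v) _ ((Finset.sum_le_univ_sum_of_nonneg
        fun v => Nat.zero_le _).trans_lt (by rwa [← Finset.mul_sum]))
    have hE'E : E' ⊆ E := hE'.trans (Finset.filter_subset _ _)
    refine hfree (containsCopy_of_incidence hT hne X (fun p hp => (Finset.mem_filter.1 (hE' hp)).2)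
      (fun p hp => hcard p (hE'E hp)) (fun p hp => hH p (hE'E hp)) η ?_ ?_ ?_)
    · intro v z
      refine le_trans (Finset.card_le_card ?_) (hη v z)
      exact Finset.filter_subset_filter _ (Finset.filter_subset_filter _ hE'E)
    · intro p hp
      have := (hdeg p hp).1
      omega
    · exact fun p hp => (hdeg p hp).2
  have hsum : E.card ≤ (t - 1) * (Fintype.card α).choose a + excess (t - 1) E := by
    rw [Finset.card_eq_sum_card_fiberwise (t := Finset.univ) (f := Prod.fst)
      fun _ _ => Finset.mem_coe.2 (Finset.mem_univ _), excess]
    have h1 : (t - 1) * (Fintype.card α).choose a =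
        ∑ S : Finset α, if S ∈ Finset.powersetCard a Finset.univ then t - 1 else 0 := by
      rw [← Finset.sum_filter, Finset.sum_const, Finset.filter_mem_eq_inter, Finset.univ_inter,
        Finset.card_powersetCard, Finset.card_univ, smul_eq_mul, mul_comm]
    rw [h1, ← Finset.sum_add_distrib]
    refine Finset.sum_le_sum fun S _ => ?_
    change (starOf E S).card ≤ _
    split_ifs with hS
    · omega
    · have : starOf E S = ∅ := by
        refine Finset.filter_eq_empty_iff.2 fun p hp hpS => hS ?_
        rw [Finset.mem_powersetCard]
        exact ⟨Finset.subset_univ _, hpS ▸ hcard p hp⟩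
      simp [this]
  omega

end Incidence

/-! ### Edges that avoid the vertices of high degree -/

section Counting

variable {α : Type*} [Fintype α] [DecidableEq α]

/-- The incidence between `(r - 1)`-sets and vertices in which every edge of `G` is split in all
possible ways, and every edge of `H` is split off its vertices in `L`. -/
def incidence (H G : Finset (Finset α)) (L : Finset α) : Finset (Finset α × α) :=
  Finset.univ.filter fun p => p.2 ∉ p.1 ∧
    (insert p.2 p.1 ∈ G ∨ insert p.2 p.1 ∈ H ∧ p.2 ∈ L)

theorem card_add_mul_card_le_card_incidence {r : ℕ} {H G : Finset (Finset α)} {L : Finset α}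
    (hH : ∀ e ∈ H, (e ∩ L).card = 1) (hG : IsUniform G r) (hHG : Disjoint H G) :
    H.card + r * G.card ≤ (incidence H G L).card := by
  let D : Finset (Σ _ : Finset α, α) := (H ∪ G).sigma fun e => if e ∈ G then e else e ∩ L
  have hD : D.card = H.card + r * G.card := by
    rw [Finset.card_sigma, Finset.sum_union hHG]
    congr 1
    · rw [Finset.card_eq_sum_ones]
      refine Finset.sum_congr rfl fun e he => ?_
      rw [if_neg (Finset.disjoint_left.1 hHG he), hH e he]
    · rw [mul_comm, ← smul_eq_mul, ← Finset.sum_const]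
      refine Finset.sum_congr rfl fun e he => ?_
      rw [if_pos he, hG e he]
  have hmem : ∀ x ∈ D, x.2 ∈ x.1 := by
    rintro ⟨e, v⟩ hx
    obtain ⟨-, hv⟩ := Finset.mem_sigma.1 hx
    simp only at hv
    split_ifs at hv with h
    · exact hv
    · exact (Finset.mem_inter.1 hv).1
  rw [← hD]
  refine Finset.card_le_card_of_injOn (fun x => (x.1.erase x.2, x.2)) ?_ ?_
  · rintro ⟨e, v⟩ hx
    have hve := hmem _ hx
    obtain ⟨he, hv⟩ := Finset.mem_sigma.1 hx
    simp only at hv hve he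
    refine Finset.mem_filter.2 ⟨Finset.mem_univ _, Finset.notMem_erase v e, ?_⟩
    simp only [Finset.insert_erase hve]
    split_ifs at hv with h
    · exact Or.inl h
    · exact Or.inr ⟨(Finset.mem_union.1 he).resolve_right h, (Finset.mem_inter.1 hv).2⟩
  · rintro ⟨e, v⟩ hx ⟨e', v'⟩ hx' hxx
    have h1 := hmem _ hx
    have h2 := hmem _ hx'
    simp only [Prod.mk.injEq] at hxx h1 h2
    obtain ⟨h3, rfl⟩ := hxx
    have : e = e' := by rw [← Finset.insert_erase h1, h3, Finset.insert_erase h2]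
    rw [this]

theorem card_filter_two_le_inter {r : ℕ} {H : Finset (Finset α)} (hH : IsUniform H r)
    (L : Finset α) : (H.filter fun e => 2 ≤ (e ∩ L).card).card ≤
      L.card * L.card * Fintype.card α ^ (r - 2) := by
  let D := (L ×ˢ L) ×ˢ Finset.powersetCard (r - 2) (Finset.univ : Finset α)
  have hsub : (H.filter fun e => 2 ≤ (e ∩ L).card) ⊆
      D.image fun x => insert x.1.1 (insert x.1.2 x.2) := by
    intro e he
    obtain ⟨he, h2⟩ := Finset.mem_filter.1 he
    obtain ⟨x, hx, y, hy, hxy⟩ := Finset.one_lt_card.1 h2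
    obtain ⟨hxe, hxL⟩ := Finset.mem_inter.1 hx
    obtain ⟨hye, hyL⟩ := Finset.mem_inter.1 hy
    have hyex : y ∈ e.erase x := Finset.mem_erase.2 ⟨hxy.symm, hye⟩
    refine Finset.mem_image.2 ⟨((x, y), (e.erase x).erase y), ?_, ?_⟩
    · refine Finset.mem_product.2 ⟨Finset.mem_product.2 ⟨hxL, hyL⟩, ?_⟩
      refine Finset.mem_powersetCard.2 ⟨Finset.subset_univ _, ?_⟩
      rw [Finset.card_erase_of_mem hyex, Finset.card_erase_of_mem hxe, hH e he]
      omega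
    · simp only
      rw [Finset.insert_erase hyex, Finset.insert_erase hxe]
  refine (Finset.card_le_card hsub).trans (Finset.card_image_le.trans ?_)
  rw [Finset.card_product, Finset.card_product, Finset.card_powersetCard, Finset.card_univ]
  exact Nat.mul_le_mul_left _ (Nat.choose_le_pow _ _)

/-- The number of edges avoiding `L`, where `L` contains all vertices of high degree. For `b ≥ 2`
these edges are few by themselves. For `b = 1`, all but few of them contribute `r` pairs to the
incidence, whereas an edge meeting `L` once contributes one pair; as there are at most
`(t - 1) * C(n, r - 1)` pairs up to an error, edges avoiding `L` are paid for by a deficit of `H`. -/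
theorem card_filter_disjoint_le {r a b s t : ℕ} (hb : 0 < b) (hba : b < a) (hr : a + b = r)
    (ht : 0 < t) {T : SimpleGraph (Fin s ⊕ Fin t)} (hT : IsTreeWithParts s t T)
    {H : Finset (Finset α)} (hH : IsUniform H r) (hfree : ¬ ContainsCopy H (blowup T a b))
    {κ : ℕ} (hκ : (s + t) * r < κ) (L : Finset α)
    (hL : ∀ x ∉ L, r ^ r * (H.filter fun e => x ∈ e).card < κ ^ (r - 1)) :
    (H.filter fun e => (e ∩ L).card = 0).card ≤
      ((t - 1) * (Fintype.card α).choose (r - 1) - H.card) +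
      2 ^ (r - 1 + t) * ((s + t) * r * (L.card * Fintype.card α ^ (r - 2) +
        r * r * ((2 ^ r) ^ (r + 1) + 1) * (κ * Fintype.card α ^ (r - 2)))) +
      2 * r * (2 ^ r) ^ (r + 1) * (2 * ((s + t) * r) + 1) * (κ * Fintype.card α ^ (r - 2)) +
      L.card * L.card * Fintype.card α ^ (r - 2) := by
  set N := Fintype.card α with hN
  set c := (2 ^ r) ^ (r + 1) with hc
  set G := H.filter fun e => (e ∩ L).card = 0 with hG
  have hGH : G ⊆ H := Finset.filter_subset _ _
  have hGu : IsUniform G r := fun e he => hH e (hGH he)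
  have hGfree : ¬ ContainsCopy G (blowup T a b) := fun ⟨φ, hφ⟩ =>
    hfree ⟨φ, fun e he => hGH (hφ e he)⟩
  have hGdeg : ∀ x, r ^ r * (G.filter fun e => x ∈ e).card < κ ^ (r - 1) := by
    intro x
    by_cases hx : x ∈ L
    · have : (G.filter fun e => x ∈ e) = ∅ := by
        refine Finset.filter_eq_empty_iff.2 fun e he hxe => ?_
        have h0 := Finset.card_eq_zero.1 (Finset.mem_filter.1 he).2
        have : x ∈ e ∩ L := Finset.mem_inter.2 ⟨hxe, hx⟩
        simp [h0] at this
      rw [this, Finset.card_empty, mul_zero]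
      exact Nat.pow_pos (by omega)
    · refine (Nat.mul_le_mul_left _ (Finset.card_le_card ?_)).trans_lt (hL x hx)
      exact Finset.filter_subset_filter _ hGH
  rcases Nat.lt_or_ge 1 b with hb2 | hb1
  · have h1 := card_le_of_two_le hb2 hba hr hT hGu hκ hGdeg hGfree
    rw [← hc, ← hN] at h1
    have h2 : c * ((2 * ((s + t) * r) + 1) * κ * N ^ (r - 2)) ≤
        2 * r * c * (2 * ((s + t) * r) + 1) * (κ * N ^ (r - 2)) := by
      calc c * ((2 * ((s + t) * r) + 1) * κ * N ^ (r - 2))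
          = 1 * (c * (2 * ((s + t) * r) + 1) * (κ * N ^ (r - 2))) := by ring
        _ ≤ 2 * r * (c * (2 * ((s + t) * r) + 1) * (κ * N ^ (r - 2))) :=
            Nat.mul_le_mul_right _ (by omega)
        _ = _ := by ring
    omega
  · obtain rfl : b = 1 := by omega
    set κ₁ := (c + 1) * κ with hκ₁
    set G₁ := lowEdges r κ₁ G with hG₁
    set H₁ := H.filter fun e => (e ∩ L).card = 1 with hH₁
    have hlow := card_sdiff_lowEdges_le hba hr hT hGu hκ hGdeg hGfree
    rw [← hc, ← hκ₁, ← hG₁, ← hN] at hlow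
    have hG₁G : G₁ ⊆ G := Finset.filter_subset _ _
    have hdisj : Disjoint H₁ G₁ := by
      refine Finset.disjoint_left.2 fun e h1 h2 => ?_
      have h3 := (Finset.mem_filter.1 h1).2
      have h4 := (Finset.mem_filter.1 (hG₁G h2)).2
      omega
    have hE := card_add_mul_card_le_card_incidence (r := r) (L := L) (H := H₁) (G := G₁)
      (fun e he => (Finset.mem_filter.1 he).2) (fun e he => hGu e (hG₁G he)) hdisj
    set E := incidence H₁ G₁ L with hEdef
    have hEH : ∀ p ∈ E, insert p.2 p.1 ∈ H := by
      intro p hp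
      rcases (Finset.mem_filter.1 hp).2.2 with h | h
      · exact hGH (hG₁G h)
      · exact (Finset.mem_filter.1 h.1).1
    have hEnot : ∀ p ∈ E, p.2 ∉ p.1 := fun p hp => (Finset.mem_filter.1 hp).2.1
    have hEcard : ∀ p ∈ E, p.1.card = a := by
      intro p hp
      have h1 := hH _ (hEH p hp)
      rw [Finset.card_insert_of_notMem (hEnot p hp)] at h1
      omega
    let η : α → ℕ := fun v => if v ∈ L then N ^ (r - 2) else r * r * (κ₁ * N ^ (r - 3))
    have hη : ∀ v z, ((linkOf E v).filter fun p => z ∈ p.1).card ≤ η v := by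
      intro v z
      have hlink : ∀ p ∈ (linkOf E v).filter fun p => z ∈ p.1, p ∈ E ∧ p.2 = v ∧ z ∈ p.1 := by
        intro p hp
        obtain ⟨hp, hz⟩ := Finset.mem_filter.1 hp
        obtain ⟨hp, hv⟩ := Finset.mem_filter.1 hp
        exact ⟨hp, hv, hz⟩
      by_cases hv : v ∈ L
      · have h1 : ((linkOf E v).filter fun p => z ∈ p.1).card ≤
            (Finset.powersetCard (r - 2) (Finset.univ : Finset α)).card := by
          refine Finset.card_le_card_of_injOn (fun p => p.1.erase z) ?_ ?_
          · intro p hp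
            obtain ⟨hpE, -, hz⟩ := hlink p hp
            refine Finset.mem_coe.2 (Finset.mem_powersetCard.2 ⟨Finset.subset_univ _, ?_⟩)
            rw [Finset.card_erase_of_mem hz, hEcard p hpE]
            omega
          · intro p hp q hq hpq
            obtain ⟨-, hpv, hpz⟩ := hlink p hp
            obtain ⟨-, hqv, hqz⟩ := hlink q hq
            simp only at hpq
            refine Prod.ext ?_ (hpv.trans hqv.symm)
            rw [← Finset.insert_erase hpz, hpq, Finset.insert_erase hqz]
        rw [Finset.card_powersetCard, Finset.card_univ] at h1
        simp only [η, if_pos hv]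
        exact h1.trans (Nat.choose_le_pow _ _)
      · simp only [η, if_neg hv]
        rcases eq_or_ne v z with rfl | hvz
        · have : ((linkOf E v).filter fun p => v ∈ p.1) = ∅ := by
            refine Finset.eq_empty_of_forall_notMem fun p hp => ?_
            obtain ⟨hpE, hpv, hpz⟩ := hlink p hp
            exact hEnot p hpE (hpv ▸ hpz)
          simp [this]
        · refine le_trans ?_ (card_lowEdges_filter_pair_le (κ := κ₁) (by omega) hGu hvz)
          refine Finset.card_le_card_of_injOn (fun p => insert p.2 p.1) ?_ ?_
          · intro p hp
            obtain ⟨hpE, hpv, hpz⟩ := hlink p hp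
            refine Finset.mem_coe.2 (Finset.mem_filter.2 ⟨?_, ?_, ?_⟩)
            · rcases (Finset.mem_filter.1 hpE).2.2 with h | h
              · exact h
              · exact absurd (hpv ▸ h.2) hv
            · exact hpv ▸ Finset.mem_insert_self _ _
            · exact Finset.mem_insert_of_mem hpz
          · intro p hp q hq hpq
            obtain ⟨hpE, hpv, -⟩ := hlink p hp
            obtain ⟨hqE, hqv, -⟩ := hlink q hq
            simp only at hpq
            refine Prod.ext ?_ (hpv.trans hqv.symm)
            rw [← Finset.erase_insert (hEnot p hpE), hpq, hpv, ← hqv,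
              Finset.erase_insert (hEnot q hqE)]
    have hinc := card_incidence_le ht hT hEcard hEnot hEH η hη hfree
    have hηsum : ∑ v, η v ≤ L.card * N ^ (r - 2) + r * r * (c + 1) * (κ * N ^ (r - 2)) := by
      have h1 : ∀ v, η v ≤ (if v ∈ L then N ^ (r - 2) else 0) + r * r * (κ₁ * N ^ (r - 3)) := by
        intro v
        simp only [η]
        split_ifs <;> omega
      refine (Finset.sum_le_sum fun v _ => h1 v).trans_eq ?_
      have h2 : N ^ (r - 2) = N * N ^ (r - 3) := by
        rw [← pow_succ']
        congr 1
        omega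
      rw [Finset.sum_add_distrib, ← Finset.sum_filter, Finset.filter_mem_eq_inter,
        Finset.univ_inter, Finset.sum_const, Finset.sum_const, Finset.card_univ, smul_eq_mul,
        smul_eq_mul, ← hN, h2, hκ₁]
      ring
    have hra : r - 1 = a := by omega
    have hra' : a + 1 = r := hr
    rw [hra', ← hra] at hinc
    have hinc' : E.card ≤ (t - 1) * N.choose (r - 1) + 2 ^ (r - 1 + t) * ((s + t) * r *
        (L.card * N ^ (r - 2) + r * r * (c + 1) * (κ * N ^ (r - 2)))) := by
      refine hinc.trans (Nat.add_le_add_left ?_ _)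
      gcongr
    have htwo := card_filter_two_le_inter hH L
    rw [← hN] at htwo
    have hsplit : H.card = H₁.card + G.card + (H.filter fun e => 2 ≤ (e ∩ L).card).card := by
      have h1 : G.card + (H.filter fun e => ¬ (e ∩ L).card = 0).card = H.card :=
        Finset.card_filter_add_card_filter_not _
      have h2 := Finset.card_filter_add_card_filter_not
        (s := H.filter fun e => ¬ (e ∩ L).card = 0) fun e => (e ∩ L).card = 1
      rw [Finset.filter_filter, Finset.filter_filter] at h2
      have h3 : (H.filter fun e => ¬ (e ∩ L).card = 0 ∧ (e ∩ L).card = 1) = H₁ :=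
        Finset.filter_congr fun e _ => by omega
      have h4 : (H.filter fun e => ¬ (e ∩ L).card = 0 ∧ ¬ (e ∩ L).card = 1) =
          H.filter fun e => 2 ≤ (e ∩ L).card :=
        Finset.filter_congr fun e _ => by omega
      rw [h3, h4] at h2
      omega
    have hGG₁ : G.card = (G \ G₁).card + G₁.card := by
      rw [Finset.card_sdiff_add_card_eq_card hG₁G]
    have h2G : 2 * G₁.card ≤ r * G₁.card := Nat.mul_le_mul_right _ (by omega)
    have hA : 2 * r * c * (2 * ((s + t) * r) + 1) * (κ * N ^ (r - 2)) =
        2 * (r * (c * ((2 * ((s + t) * r) + 1) * κ * N ^ (r - 2)))) := by ring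
    rw [hA]
    omega

/-- Few vertices have high degree. -/
theorem card_mul_le_of_degree {r d : ℕ} {H : Finset (Finset α)} (hH : IsUniform H r) (k : ℕ) :
    (Finset.univ.filter fun x : α => d ≤ k * (H.filter fun e => x ∈ e).card).card * d ≤
      k * (r * H.card) := by
  set L := Finset.univ.filter fun x : α => d ≤ k * (H.filter fun e => x ∈ e).card
  have hsum : ∑ x : α, (H.filter fun e => x ∈ e).card = r * H.card := by
    have h1 : ∑ x : α, (H.filter fun e => x ∈ e).card = ∑ e ∈ H, e.card := by
      simp only [Finset.card_filter]
      rw [Finset.sum_comm]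
      refine Finset.sum_congr rfl fun e _ => ?_
      simp
    rw [h1, Finset.sum_congr rfl hH, Finset.sum_const, smul_eq_mul, mul_comm]
  calc L.card * d ≤ ∑ x ∈ L, k * (H.filter fun e => x ∈ e).card := by
        rw [← smul_eq_mul]
        exact Finset.card_nsmul_le_sum _ _ _ fun x hx => (Finset.mem_filter.1 hx).2
    _ ≤ ∑ x : α, k * (H.filter fun e => x ∈ e).card :=
        Finset.sum_le_univ_sum_of_nonneg fun _ => Nat.zero_le _
    _ = k * (r * H.card) := by rw [← Finset.mul_sum, hsum]

end Counting

/-! ### The choice of the degree threshold -/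

theorem errorTerm_pos {r n : ℕ} {m : ℝ} (hn : 0 < n) (hm : 0 < m) : 0 < errorTerm r n m := by
  have : (0 : ℝ) < n := by exact_mod_cast hn
  unfold errorTerm
  positivity

theorem sq_le_of_le_rpow {t n : ℕ} {m γ : ℝ} (ht : 2 ≤ t) (hn : 1 ≤ n) (hm0 : 0 ≤ m)
    (hγ : γ < 1 / (t : ℝ)) (hm : m ≤ (n : ℝ) ^ γ) : m ^ 2 ≤ n := by
  have hn' : (1 : ℝ) ≤ n := by exact_mod_cast hn
  have ht' : (2 : ℝ) ≤ t := by exact_mod_cast ht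
  have h1 : γ ≤ 1 / 2 := hγ.le.trans (one_div_le_one_div_of_le (by norm_num) ht')
  calc m ^ 2 ≤ ((n : ℝ) ^ γ) ^ 2 := by gcongr
    _ = (n : ℝ) ^ (γ * 2) := by
        rw [Real.rpow_mul (by positivity)]
        norm_num
    _ ≤ (n : ℝ) ^ (1 : ℝ) := Real.rpow_le_rpow_of_exponent_le hn' (by linarith)
    _ = n := Real.rpow_one _

theorem inv_le_rpow_neg {r : ℕ} {m : ℝ} (hr : 1 ≤ r) (hm : 1 ≤ m) :
    m⁻¹ ≤ m ^ (-(1 / (r : ℝ))) := by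
  have hr' : (1 : ℝ) ≤ r := by exact_mod_cast hr
  rw [← Real.rpow_neg_one]
  refine Real.rpow_le_rpow_of_exponent_le hm ?_
  have : 1 / (r : ℝ) ≤ 1 := by rw [div_le_one (by linarith)]; exact hr'
  linarith

theorem inv_le_rpow_neg_pow {r : ℕ} {m : ℝ} (hr : 1 ≤ r) (hm : 1 ≤ m) :
    m⁻¹ ≤ (m ^ (-(1 / (r : ℝ)))) ^ (r - 1) := by
  have hr' : (1 : ℝ) ≤ r := by exact_mod_cast hr
  rw [← Real.rpow_neg_one, ← Real.rpow_natCast, ← Real.rpow_mul (by linarith)]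
  refine Real.rpow_le_rpow_of_exponent_le hm ?_
  rw [Nat.cast_sub hr, Nat.cast_one]
  have : 1 / (r : ℝ) * (r - 1) ≤ 1 := by
    rw [one_div_mul_eq_div, div_le_one (by linarith)]
    linarith
  linarith

theorem errorTerm_le {r n : ℕ} {m : ℝ} (hr : 2 ≤ r) (hm1 : 1 ≤ m) (hm : m ^ 2 ≤ n) :
    errorTerm r n m ≤ 2 * (n : ℝ) ^ (r - 1) := by
  have h1 : m ^ (-(1 / (r : ℝ))) ≤ 1 := Real.rpow_le_one_of_one_le_of_nonpos hm1 (by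
    rw [neg_nonpos]; positivity)
  have h2 : (n : ℝ) ^ (r - 1) = n * (n : ℝ) ^ (r - 2) := by
    rw [← pow_succ']
    congr 1
    omega
  unfold errorTerm
  calc m ^ (-(1 / (r : ℝ))) * (n : ℝ) ^ (r - 1) + m ^ 2 * (n : ℝ) ^ (r - 2)
      ≤ 1 * (n : ℝ) ^ (r - 1) + n * (n : ℝ) ^ (r - 2) := by gcongr
    _ = 2 * (n : ℝ) ^ (r - 1) := by rw [h2]; ring

/-- The degree threshold `κ`, a constant times `n * m ^ (-1 / r)`: deleting `(r - 1)`-sets or pairs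
of coordinates below it costs `O(f(m))` edges, while only `O(m)` vertices can have degree at least
`κ ^ (r - 1)`. -/
theorem exists_threshold {r n : ℕ} {m : ℝ} (hr : 2 ≤ r) (hm1 : 1 ≤ m) (hm : m ≤ n) (q : ℕ) :
    ∃ κ : ℕ, q < κ ∧ (κ : ℝ) * (n : ℝ) ^ (r - 2) ≤ (q + 2) * errorTerm r n m ∧
      (n : ℝ) ^ (r - 1) ≤ m * (κ : ℝ) ^ (r - 1) := by
  set y : ℝ := m ^ (-(1 / (r : ℝ))) with hy
  have hm0 : 0 < m := by linarith
  have hy0 : 0 < y := Real.rpow_pos_of_pos hm0 _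
  have hx1 : 1 ≤ n * y := by
    calc (1 : ℝ) = m * m⁻¹ := (mul_inv_cancel₀ hm0.ne').symm
      _ ≤ n * y := mul_le_mul hm (inv_le_rpow_neg (by omega) hm1) (by positivity) (by positivity)
  have hlow : (q + 1) * (n * y) ≤ (⌈(q + 1) * (n * y)⌉₊ : ℝ) := Nat.le_ceil _
  have hup : (⌈(q + 1) * (n * y)⌉₊ : ℝ) ≤ (q + 2) * (n * y) := by
    have := Nat.ceil_lt_add_one (a := ((q : ℝ) + 1) * (n * y)) (by positivity)
    nlinarith
  have hq0 : (0 : ℝ) ≤ q := Nat.cast_nonneg q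
  refine ⟨⌈((q : ℝ) + 1) * (n * y)⌉₊, ?_, ?_, ?_⟩
  · have h1 : (q : ℝ) + 1 ≤ (q + 1) * (n * y) := by nlinarith
    have h2 : (q : ℝ) < ⌈((q : ℝ) + 1) * (n * y)⌉₊ := by linarith
    exact_mod_cast h2
  · have h2 : (n : ℝ) ^ (r - 1) = n * (n : ℝ) ^ (r - 2) := by
      rw [← pow_succ']
      congr 1
      omega
    calc (⌈((q : ℝ) + 1) * (n * y)⌉₊ : ℝ) * (n : ℝ) ^ (r - 2)
        ≤ (q + 2) * (n * y) * (n : ℝ) ^ (r - 2) := by gcongr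
      _ = (q + 2) * (y * (n : ℝ) ^ (r - 1) + 0) := by rw [h2]; ring
      _ ≤ (q + 2) * errorTerm r n m := by
          unfold errorTerm
          gcongr
          positivity
  · calc (n : ℝ) ^ (r - 1) = m * m⁻¹ * (n : ℝ) ^ (r - 1) := by
          rw [mul_inv_cancel₀ hm0.ne', one_mul]
      _ ≤ m * y ^ (r - 1) * (n : ℝ) ^ (r - 1) := by
          gcongr
          exact inv_le_rpow_neg_pow (by omega) hm1
      _ = m * (n * y) ^ (r - 1) := by rw [mul_pow]; ring
      _ ≤ m * (⌈((q : ℝ) + 1) * (n * y)⌉₊ : ℝ) ^ (r - 1) := by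
          gcongr
          refine le_trans ?_ hlow
          nlinarith

end HypergraphBlowup

theorem mainTheorem5 (r a b s t : ℕ) (γ : ℝ) (hb : 0 < b) (hba : b < a) (hr : a + b = r)
    (ht : 0 < t) (hts : t ≤ s) (hγ0 : 0 < γ) (hγ1 : γ < 1 / (t : ℝ)) :
    ∃ n₀ : ℕ, ∀ C : ℝ, ∃ C' : ℝ, ∀ n : ℕ, n₀ ≤ n →
      ∀ m : ℝ, (r : ℝ) ^ r < m → m ≤ (n : ℝ) ^ γ →
      ∀ T : SimpleGraph (Fin s ⊕ Fin t), HypergraphBlowup.IsTreeWithParts s t T →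
      ∀ H : Finset (Finset (Fin n)), HypergraphBlowup.IsUniform H r →
        ¬ HypergraphBlowup.ContainsCopy H (HypergraphBlowup.blowup T a b) →
        |(H.card : ℝ) - ((t : ℝ) - 1) * (n.choose (r - 1) : ℝ)|
          ≤ C * HypergraphBlowup.errorTerm r n m →
        ∃ F : Finset (Finset (Fin n)), F ⊆ H ∧
          (H.card : ℝ) - (F.card : ℝ) ≤ C' * HypergraphBlowup.errorTerm r n m ∧
          ∃ L : Finset (Fin n), HypergraphBlowup.IsCrosscut F L ∧ (L.card : ℝ) ≤ C' * m := by
  classical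
  refine ⟨1, fun C => ?_⟩
  rcases Nat.lt_or_ge 1 t with ht2 | ht1
  swap
  · -- For `t = 1` the main term vanishes and the empty subfamily will do.
    obtain rfl : t = 1 := by omega
    refine ⟨|C|, fun n hn m hm _ T _ H _ _ hcard => ⟨∅, Finset.empty_subset _, ?_, ∅, ?_, ?_⟩⟩
    · have hm0 : 0 < m := lt_of_le_of_lt (by positivity) hm
      have hf := HypergraphBlowup.errorTerm_pos (r := r) hn hm0
      have h1 : C * HypergraphBlowup.errorTerm r n m ≤ |C| * HypergraphBlowup.errorTerm r n m :=
        mul_le_mul_of_nonneg_right (le_abs_self C) hf.le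
      have h2 := (le_abs_self _).trans hcard
      simp only [Nat.cast_one, sub_self, zero_mul, sub_zero] at h2
      simpa using h2.trans h1
    · intro e he
      simp at he
    · have hm0 : 0 < m := lt_of_le_of_lt (by positivity) hm
      simpa using mul_nonneg (abs_nonneg C) hm0.le
  set q := (s + t) * r with hq
  set c := (2 ^ r) ^ (r + 1) with hc
  -- `ℓ` bounds `|L| / m`, and `K` the number of edges avoiding `L`, relative to the error term.
  set ℓ : ℝ := r ^ r * r * (t + 2 * |C|) with hℓ
  have hℓ0 : 0 ≤ ℓ := by positivity
  set K : ℝ := |C| + 2 ^ (r - 1 + t) * (q * (ℓ + r * r * (c + 1) * (q + 2))) +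
    2 * r * c * (2 * q + 1) * (q + 2) + ℓ ^ 2 with hK
  have hK0 : 0 ≤ K := by positivity
  refine ⟨ℓ + K + ℓ ^ 2, fun n hn m hmr hmn T hT H hH hfree hcard => ?_⟩
  have hm1 : 1 ≤ m := by
    have h1 : (1 : ℝ) ≤ (r : ℝ) ^ r := one_le_pow₀ (by exact_mod_cast (by omega : 1 ≤ r))
    linarith
  have hm0 : 0 < m := by linarith
  have hm2 : m ^ 2 ≤ n := HypergraphBlowup.sq_le_of_le_rpow ht2 hn hm0.le hγ1 hmn
  have hm_le : m ≤ n := by nlinarith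
  set f := HypergraphBlowup.errorTerm r n m with hf
  have hf0 : 0 < f := HypergraphBlowup.errorTerm_pos hn hm0
  have hf2 : f ≤ 2 * (n : ℝ) ^ (r - 1) := HypergraphBlowup.errorTerm_le (by omega) hm1 hm2
  have hfm : m ^ 2 * (n : ℝ) ^ (r - 2) ≤ f := by
    rw [hf, HypergraphBlowup.errorTerm]
    have : 0 ≤ m ^ (-(1 / (r : ℝ))) * (n : ℝ) ^ (r - 1) := by positivity
    linarith
  have hCf : C * f ≤ |C| * f := mul_le_mul_of_nonneg_right (le_abs_self C) hf0.le
  obtain ⟨hlo, hhi⟩ := abs_le.1 (hcard.trans hCf)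
  obtain ⟨κ, hκq, hκf, hκm⟩ := HypergraphBlowup.exists_threshold (r := r) (by omega) hm1 hm_le q
  rw [← hf] at hκf
  set L : Finset (Fin n) := Finset.univ.filter fun x =>
    κ ^ (r - 1) ≤ r ^ r * (H.filter fun e => x ∈ e).card with hLdef
  have hLm : (L.card : ℝ) ≤ ℓ * m := by
    have h1 : (L.card : ℝ) * (κ : ℝ) ^ (r - 1) ≤ (r : ℝ) ^ r * (r * H.card) := by
      exact_mod_cast HypergraphBlowup.card_mul_le_of_degree hH (r ^ r)
    have hch : (n.choose (r - 1) : ℝ) ≤ (n : ℝ) ^ (r - 1) := by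
      exact_mod_cast Nat.choose_le_pow n (r - 1)
    have ht1 : (1 : ℝ) ≤ t := by exact_mod_cast ht
    have h2 : (H.card : ℝ) ≤ (t + 2 * |C|) * (n : ℝ) ^ (r - 1) := by
      have h3 : ((t : ℝ) - 1) * (n.choose (r - 1) : ℝ) ≤ t * (n : ℝ) ^ (r - 1) := by
        refine mul_le_mul (by linarith) hch (by positivity) (by positivity)
      have h4 : |C| * f ≤ |C| * (2 * (n : ℝ) ^ (r - 1)) := by gcongr
      linarith
    have hκ0 : (0 : ℝ) < (κ : ℝ) ^ (r - 1) := by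
      have : (0 : ℝ) < κ := by exact_mod_cast (by omega : 0 < κ)
      positivity
    refine le_of_mul_le_mul_right ?_ hκ0
    calc (L.card : ℝ) * (κ : ℝ) ^ (r - 1) ≤ (r : ℝ) ^ r * (r * H.card) := h1
      _ ≤ (r : ℝ) ^ r * (r * ((t + 2 * |C|) * (n : ℝ) ^ (r - 1))) := by gcongr
      _ ≤ (r : ℝ) ^ r * (r * ((t + 2 * |C|) * (m * (κ : ℝ) ^ (r - 1)))) := by gcongr
      _ = ℓ * m * (κ : ℝ) ^ (r - 1) := by rw [hℓ]; ring
  have hL1 : (L.card : ℝ) * (n : ℝ) ^ (r - 2) ≤ ℓ * f := by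
    calc (L.card : ℝ) * (n : ℝ) ^ (r - 2) ≤ ℓ * m * (n : ℝ) ^ (r - 2) := by gcongr
      _ ≤ ℓ * m ^ 2 * (n : ℝ) ^ (r - 2) := by gcongr; nlinarith
      _ = ℓ * (m ^ 2 * (n : ℝ) ^ (r - 2)) := by ring
      _ ≤ ℓ * f := by gcongr
  have hL2 : (L.card : ℝ) * L.card * (n : ℝ) ^ (r - 2) ≤ ℓ ^ 2 * f := by
    calc (L.card : ℝ) * L.card * (n : ℝ) ^ (r - 2) ≤ (ℓ * m) * (ℓ * m) * (n : ℝ) ^ (r - 2) := by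
          gcongr
      _ = ℓ ^ 2 * (m ^ 2 * (n : ℝ) ^ (r - 2)) := by ring
      _ ≤ ℓ ^ 2 * f := by gcongr
  have hzero : ((H.filter fun e => (e ∩ L).card = 0).card : ℝ) ≤ K * f := by
    have h1 := HypergraphBlowup.card_filter_disjoint_le hb hba hr ht hT hH hfree hκq L (by
      intro x hx
      by_contra! hle
      exact hx (Finset.mem_filter.2 ⟨Finset.mem_univ _, hle⟩))
    rw [Fintype.card_fin, ← hc, ← hq] at h1
    have hdef : (((t - 1) * n.choose (r - 1) - H.card : ℕ) : ℝ) ≤ |C| * f := by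
      rcases le_total ((t - 1) * n.choose (r - 1)) H.card with h | h
      · rw [Nat.sub_eq_zero_of_le h, Nat.cast_zero]
        positivity
      · rw [Nat.cast_sub h, Nat.cast_mul, Nat.cast_sub ht, Nat.cast_one]
        linarith
    have h2 : ((H.filter fun e => (e ∩ L).card = 0).card : ℝ) ≤
        (((t - 1) * n.choose (r - 1) - H.card : ℕ) : ℝ) +
        2 ^ (r - 1 + t) * (q * (L.card * (n : ℝ) ^ (r - 2) +
          r * r * (c + 1) * (κ * (n : ℝ) ^ (r - 2)))) +
        2 * r * c * (2 * q + 1) * (κ * (n : ℝ) ^ (r - 2)) +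
        L.card * L.card * (n : ℝ) ^ (r - 2) := by
      exact_mod_cast h1
    calc ((H.filter fun e => (e ∩ L).card = 0).card : ℝ) ≤ _ := h2
      _ ≤ |C| * f + 2 ^ (r - 1 + t) * (q * (ℓ * f + r * r * (c + 1) * ((q + 2) * f))) +
          2 * r * c * (2 * q + 1) * ((q + 2) * f) + ℓ ^ 2 * f := by gcongr
      _ = K * f := by rw [hK]; ring
  have htwo : ((H.filter fun e => 2 ≤ (e ∩ L).card).card : ℝ) ≤ ℓ ^ 2 * f := by
    refine le_trans ?_ hL2
    have := HypergraphBlowup.card_filter_two_le_inter hH L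
    rw [Fintype.card_fin] at this
    exact_mod_cast this
  refine ⟨H.filter fun e => (e ∩ L).card = 1, Finset.filter_subset _ _, ?_, L, ?_, ?_⟩
  · have hsplit : H.card ≤ (H.filter fun e => (e ∩ L).card = 1).card +
        (H.filter fun e => (e ∩ L).card = 0).card + (H.filter fun e => 2 ≤ (e ∩ L).card).card := by
      have hsub : H ⊆ (H.filter fun e => (e ∩ L).card = 1) ∪
          (H.filter fun e => (e ∩ L).card = 0) ∪ H.filter fun e => 2 ≤ (e ∩ L).card := by
        intro e he
        simp only [Finset.mem_union, Finset.mem_filter, he, true_and]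
        omega
      exact (Finset.card_le_card hsub).trans ((Finset.card_union_le _ _).trans
        (Nat.add_le_add_right (Finset.card_union_le _ _) _))
    have hsplit' : (H.card : ℝ) ≤ (H.filter fun e => (e ∩ L).card = 1).card +
        (H.filter fun e => (e ∩ L).card = 0).card +
        (H.filter fun e => 2 ≤ (e ∩ L).card).card := by exact_mod_cast hsplit
    have h3 : 0 ≤ ℓ * f := by positivity
    have h4 : (ℓ + K + ℓ ^ 2) * f = ℓ * f + K * f + ℓ ^ 2 * f := by ring
    linarith
  · intro e he
    convert (Finset.mem_filter.1 he).2
  · refine hLm.trans (mul_le_mul_of_nonneg_right ?_ hm0.le)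
    have : 0 ≤ ℓ ^ 2 := by positivity
    linarith
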